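/- Let $f,g,\varphi_1,\dots,\varphi_s\in\mathbb R[x]$, $x=(x_1,\dots,x_m)$, let $p\in\mathbb R[x,y]$, $y=(y_1,\dots,y_n)$, and let $\mathbf Y\subset\mathbb R^n$. Put $$\mathbf K=\{x\in\mathbb R^m:\ \varphi_j(x)\le 0\ (1\le j\le s),\ p(x,y)\le 0\ \ \forall y\in\mathbf Y\},\qquad r^\star=\min_{x\in\mathbf K}\frac{f(x)}{g(x)},$$ and let $\mathbf S$ be the set of minimizers. A polynomial $h\in\mathbb R[x]$ is *s.o.s-convex* if $\nabla^2h=H^TH$ for some polynomial matrix $H\in\mathbb R[x]^{r\times m}$. Fix $\mathfrak R>0$ and $g^\star>0$ such that some $u^\star\in\mathbf S$ satisfies $\|u^\star\|<\mathfrak R$ and $g(u^\star)>g^\star$ (in particular $\mathbf S\ne\emptyset$). Let $d_y=\deg_y p$ and $$\mathbf d=\big\lceil \max\{\deg f,\deg g,\deg\varphi_1,\dots,\deg\varphi_s,\deg_xp\}/2\big\rceil ,$$ and suppose $\mathbf d\ge 1$ (that is, not all of the data are constant in $x$). Let $\Sigma^2[\cdot]$ be the set of sums of squares of polynomials and $\Sigma^2_k[\cdot]$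 the set of those of degree at most $2k$. For $k\in\mathbb N$ put $$\mathcal P^k=\Big\{\psi\in\mathbb R[y]_{d_y}:\ \int_{\mathbf Y}\psi\,\sigma\,dy\ge 0\ \ \forall\sigma\in\Sigma^2_k[y]\Big\}.$$ With $q_0=1$, $q_1=\mathfrak R^2-\|x\|^2$, $q_2=g-g^\star$, let $$\mathbf M=\Big\{\sum_{j=0}^2\sigma_jq_j:\ \sigma_j\in\Sigma^2[x],\ \deg(\sigma_jq_j)\le 2\mathbf d\Big\}.$$ For a linear functional $\mathscr L$ on $\mathbb R[x]_{2\mathbf d}$ let $\mathscr L(p(x,y))\in\mathbb R[y]$ be the result of applying $\mathscr L$ to $p$ regarded as a polynomial in $x$ with coefficients in $\mathbb R[y]$, and let $\mathscr L(x)=(\mathscr L(x_1),\dots,\mathscr L(x_m))$. Let $r_k^{\mathrm{dual}}$ be the infimum of $\mathscr L(f)$ over all linear functionals $\mathscr L$ on $\mathbb R[x]_{2\mathbf d}$ with $$\mathscr L\ge 0\text{ on }\mathbf M,\quad \mathscr L(g)=1,\quad -\mathscr L(p(x,y))\in\mathcal P^k,\quad \mathscr L(\varphi_j)\le 0\ (1\le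 j\le s),$$ and let $\Lambda_k\subset\mathbb R^m$ be the set of the points $\mathscr L(x)$ for all linear functionals $\mathscr L$ on $\mathbb R[x]_{2\mathbf d}$ with $$\mathscr L(\sigma_0)\ge 0\ \ \forall\sigma_0\in\Sigma^2_{\mathbf d}[x],\quad \mathscr L\big((\mathfrak R^2-\|x\|^2)\sigma\big)\ge 0\ \ \forall\sigma\in\Sigma^2_{\mathbf d-1}[x],$$ $$-\mathscr L(p(x,y))\in\mathcal P^k,\quad \mathscr L(1)=1,\quad \mathscr L(\varphi_j)\le 0\ (1\le j\le s).$$ Assume: - **A1:** $\mathbf Y\subseteq[-1,1]^n$ is closed, and $\varphi_1,\dots,\varphi_s$ and $p(\cdot,y)$, $y\in\mathbf Y$, are s.o.s-convex. - **A2:** $f$ and $-g$ are s.o.s-convex, and either $f>0$ and $g>0$ on $\mathbf K$, or $g$ is affine and $g>0$ on $\mathbf K$. - **A3:** there is $u\in\mathbf K$ with $p(u,y)<0$ for all $y\in\mathbf Y$ and $\varphi_j(u)<0$ for all $j$. - **A4:** there is $\bar x\in\mathbb R^m$ with $\|\bar x\|<\mathfrak R$ and $p(\bar x,y)<0$ for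 all $y\in\mathbf Y$. - **A5:** there are $\epsilon_{\mathbf Y},\eta_{\mathbf Y}>0$ such that $\mathrm{vol}(\mathbf B^n_\delta(y)\cap\mathbf Y)\ge\eta_{\mathbf Y}\,\mathrm{vol}(\mathbf B^n_\delta(y))$ for all $y\in\mathbf Y$ and $0<\delta<\epsilon_{\mathbf Y}$, where $\mathbf B^n_\delta(y)$ is the ball with centre $y$ and radius $\delta$. Then, with $\mathbf B_{\mathfrak R}=\{x\in\mathbb R^m:\|x\|\le\mathfrak R\}$, as $k\to\infty$, $$\sup_{u\in\Lambda_k}\mathrm{dist}\big(u,\ \mathbf K\cap\mathbf B_{\mathfrak R}\big)=O\Big(\frac{\log k}{k}\Big);$$ moreover $r_k^{\mathrm{dual}}$ is finite and $r_k^{\mathrm{dual}}\le r^\star$ for every $k\in\mathbb N$, and $$0\le r^\star-r_k^{\mathrm{dual}}=O\Big(\frac{\log k}{k}\Big).$$ -/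

import Mathlib

open MvPolynomial MeasureTheory Filter Asymptotics

noncomputable section

/-- The data of a fractional semi-infinite polynomial program
`min f(x)/g(x)` subject to `φ₁(x) ≤ 0, …, φₛ(x) ≤ 0` and `p(x,y) ≤ 0` for all `y ∈ Y`,
with `x ∈ ℝᵐ` and `y ∈ ℝⁿ`.  The polynomial `p ∈ ℝ[x,y]` is stored as a polynomial in `x`
with coefficients in `ℝ[y]`. -/
structure FSIPP (m n s : ℕ) where
  f : MvPolynomial (Fin m) ℝ
  g : MvPolynomial (Fin m) ℝ
  φ : Fin s → MvPolynomial (Fin m) ℝ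
  p : MvPolynomial (Fin m) (MvPolynomial (Fin n) ℝ)
  Y : Set (EuclideanSpace ℝ (Fin n))

/-- `h` is s.o.s-convex: its Hessian is `Hᵀ H` for some `r × m` polynomial matrix `H`. -/
def IsSosConvex {m : ℕ} (h : MvPolynomial (Fin m) ℝ) : Prop :=
  ∃ (r : ℕ) (H : Matrix (Fin r) (Fin m) (MvPolynomial (Fin m) ℝ)),
    (Matrix.of fun i j => pderiv i (pderiv j h)) = H.transpose * H

namespace FSIPP

variable {m n s : ℕ} (P : FSIPP m n s)

/-- The polynomial `p(·, y) ∈ ℝ[x]`, for a fixed point `y`. -/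
def pAt (y : EuclideanSpace ℝ (Fin n)) : MvPolynomial (Fin m) ℝ :=
  P.p.map (eval y.ofLp)

/-- The feasible set `K`. -/
def K : Set (EuclideanSpace ℝ (Fin m)) :=
  {x | (∀ j, eval x.ofLp (P.φ j) ≤ 0) ∧ ∀ y ∈ P.Y, eval x.ofLp (P.pAt y) ≤ 0}

/-- The objective `f(x)/g(x)`. -/
def obj (x : EuclideanSpace ℝ (Fin m)) : ℝ := eval x.ofLp P.f / eval x.ofLp P.g

/-- The set `S` of optimal solutions. -/
def S : Set (EuclideanSpace ℝ (Fin m)) := {x | x ∈ P.K ∧ ∀ z ∈ P.K, P.obj x ≤ P.obj z}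

/-- The optimal value `r⋆` (a minimum as soon as `S` is non-empty). -/
def rStar : ℝ := sInf (P.obj '' P.K)

/-- The degree of `p` in `y`. -/
def degY : ℕ := P.p.support.sup fun α => (P.p.coeff α).totalDegree

/-- The largest of the degrees in `x` of `f`, `g`, the `φⱼ` and `p`. -/
def maxDeg : ℕ :=
  max (max P.f.totalDegree P.g.totalDegree)
    (max (Finset.univ.sup fun j => (P.φ j).totalDegree) P.p.totalDegree)

/-- The integer `d = ⌈maxDeg / 2⌉`. -/
def d : ℕ := (P.maxDeg + 1) / 2

/-- The space `ℝ[x]_{2d}` of polynomials of degree at most `2d`. -/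
abbrev polyX : Submodule ℝ (MvPolynomial (Fin m) ℝ) :=
  restrictTotalDegree (Fin m) ℝ (2 * P.d)

theorem maxDeg_le : P.maxDeg ≤ 2 * P.d := by unfold d; omega

theorem f_mem : P.f ∈ P.polyX :=
  (mem_restrictTotalDegree _ _ _).2
    (((le_max_left _ _).trans (le_max_left _ _)).trans P.maxDeg_le)

theorem g_mem : P.g ∈ P.polyX :=
  (mem_restrictTotalDegree _ _ _).2
    (((le_max_right _ _).trans (le_max_left _ _)).trans P.maxDeg_le)

theorem φ_mem (j : Fin s) : P.φ j ∈ P.polyX :=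
  (mem_restrictTotalDegree _ _ _).2
    ((((Finset.le_sup (f := fun j => (P.φ j).totalDegree) (Finset.mem_univ j)).trans
      (le_max_left _ _)).trans (le_max_right _ _)).trans P.maxDeg_le)

theorem one_mem : (1 : MvPolynomial (Fin m) ℝ) ∈ P.polyX :=
  (mem_restrictTotalDegree _ _ _).2 (by simp)

theorem X_mem (hd : 1 ≤ P.d) (i : Fin m) : (X i : MvPolynomial (Fin m) ℝ) ∈ P.polyX :=
  (mem_restrictTotalDegree _ _ _).2 (by rw [totalDegree_X]; omega)

theorem monomial_mem {α : Fin m →₀ ℕ} (hα : α ∈ P.p.support) :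
    monomial α (1 : ℝ) ∈ P.polyX :=
  (mem_restrictTotalDegree _ _ _).2 <| by
    rw [totalDegree_monomial _ one_ne_zero]
    exact (le_totalDegree hα).trans
      (((le_max_right _ _).trans (le_max_right _ _)).trans P.maxDeg_le)

/-- For a linear functional `L` on `ℝ[x]_{2d}`, the polynomial `L(p(x,y)) ∈ ℝ[y]` that is obtained
by applying `L` to `p` regarded as a polynomial in `x` with coefficients in `ℝ[y]`. -/
def applyP (L : Module.Dual ℝ P.polyX) : MvPolynomial (Fin n) ℝ :=
  ∑ α ∈ P.p.support.attach, L ⟨monomial α.1 1, P.monomial_mem α.2⟩ • P.p.coeff α.1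

/-- The outer approximation `𝒫ᵏ(Y)` of the cone of polynomials of degree at most `deg_y p` that are
nonnegative on `Y`: those `ψ` with `∫_Y ψ σ dy ≥ 0` for all s.o.s `σ` of degree at most `2k`. -/
def outerCone (k : ℕ) : Set (MvPolynomial (Fin n) ℝ) :=
  {ψ | ψ.totalDegree ≤ P.degY ∧
    ∀ σ : MvPolynomial (Fin n) ℝ, IsSumSq σ → σ.totalDegree ≤ 2 * k →
      0 ≤ ∫ y in P.Y, eval y.ofLp ψ * eval y.ofLp σ}

/-- The polynomial `R² - ‖x‖²`. -/
def ballPoly (m : ℕ) (R : ℝ) : MvPolynomial (Fin m) ℝ := C (R ^ 2) - ∑ i, X i ^ 2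

/-- The truncated quadratic module `M_d(Q)` generated by `q₁ = R² - ‖x‖²` and `q₂ = g - g⋆`. -/
def quadModule (R gStar : ℝ) : Set (MvPolynomial (Fin m) ℝ) :=
  {q | ∃ σ₀ σ₁ σ₂ : MvPolynomial (Fin m) ℝ,
    IsSumSq σ₀ ∧ IsSumSq σ₁ ∧ IsSumSq σ₂ ∧
    σ₀.totalDegree ≤ 2 * P.d ∧
    (σ₁ * ballPoly m R).totalDegree ≤ 2 * P.d ∧
    (σ₂ * (P.g - C gStar)).totalDegree ≤ 2 * P.d ∧
    q = σ₀ + σ₁ * ballPoly m R + σ₂ * (P.g - C gStar)}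

/-- The feasible set of the `k`-th dual relaxation. -/
def dualFeasible (R gStar : ℝ) (k : ℕ) : Set (Module.Dual ℝ P.polyX) :=
  {L | (∀ q : P.polyX, (q : MvPolynomial (Fin m) ℝ) ∈ P.quadModule R gStar → 0 ≤ L q) ∧
    L ⟨P.g, P.g_mem⟩ = 1 ∧
    -P.applyP L ∈ P.outerCone k ∧
    ∀ j, L ⟨P.φ j, P.φ_mem j⟩ ≤ 0}

/-- The optimal value `r_k^dual` of the `k`-th dual relaxation, as an infimum in `[-∞, +∞]`. -/
def rDual (R gStar : ℝ) (k : ℕ) : EReal :=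
  ⨅ L ∈ P.dualFeasible R gStar k, ((L ⟨P.f, P.f_mem⟩ : ℝ) : EReal)

/-- The linear functionals that define the outer approximation `Λ_k`. -/
def outerFeasible (R : ℝ) (k : ℕ) : Set (Module.Dual ℝ P.polyX) :=
  {L | (∀ q : P.polyX, IsSumSq (q : MvPolynomial (Fin m) ℝ) → 0 ≤ L q) ∧
    (∀ q : P.polyX, (∃ σ : MvPolynomial (Fin m) ℝ, IsSumSq σ ∧
      σ.totalDegree ≤ 2 * (P.d - 1) ∧ (q : MvPolynomial (Fin m) ℝ) = ballPoly m R * σ) →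
      0 ≤ L q) ∧
    -P.applyP L ∈ P.outerCone k ∧
    L ⟨1, P.one_mem⟩ = 1 ∧
    ∀ j, L ⟨P.φ j, P.φ_mem j⟩ ≤ 0}

/-- The outer approximation `Λ_k`, the set of the points `(L(x₁), …, L(xₘ))`.  The hypothesis
`1 ≤ d` says that the coordinates `xᵢ` lie in the domain `ℝ[x]_{2d}` of `L`. -/
def Lam (hd : 1 ≤ P.d) (R : ℝ) (k : ℕ) : Set (EuclideanSpace ℝ (Fin m)) :=
  {u | ∃ L ∈ P.outerFeasible R k, ∀ i, u i = L ⟨X i, P.X_mem hd i⟩}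

end FSIPP

end

/-!
Each relaxation replaces points by functionals `L` on the polynomials of degree at most `2d`, and
everything is read off from the point `u = L(x)` of first moments.

*Jensen.* If `h` is s.o.s-convex and `L(1) = 1`, then `h(u) ≤ L(h)` (`IsSosConvex.jensen`). So `u`
satisfies the constraints `φⱼ ≤ 0`, and `p(u, y) ≤ L(p(·, y))`.

*Needles.* The polynomial `ψ = -L(p(x, y))` has nonnegative integrals over `Y` against the sums of
squares `σ` of degree at most `2k`. Taking for `σ` the square of a shifted Chebyshev polynomial in
`‖y - y₀‖²`, which is at most `1` at distance `δ` from `y₀` and at least `exp(c k δ) / 4` within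
distance `δ / 2`, the volume density of `Y` shows that `ψ(y₀) < -2 Lip δ` is impossible, for large
`k`, when `δ = b log k / k` with a suitable constant `b` (`exists_rate_of_integral_nonneg`). The
bound and the Lipschitz constant of `ψ` on `Y` do not depend on `L`, because the ball constraint
bounds all the moments of `L` (`IsBallPseudoMoment.abs_moment_le`). Hence `p(u, y) ≤ A log k / k`
on `Y`.

*Slater.* A point between a minimizer inside the ball and a Slater point is a Slater point inside
the ball. Moving `u` towards it by a step of order `log k / k` gives a point of `K` in the ball
(`FSIPP.combo_mem_K`), which is the estimate for `Λ_k`.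

*Values.* The evaluation at a minimizer, divided by the value of `g`, is dual feasible, whence
`r_k ≤ r⋆`. Conversely a dual feasible `L` has `0 < L(1) ≤ 1 / g⋆`, and `L / L(1)` is one of the
functionals above. The polynomial `F = f - r⋆ g` is s.o.s-convex and nonnegative on `K`, so
`F(u) ≥ -O(log k / k)` by convexity along the same segment, and Jensen's inequality gives
`L(f) - r⋆ = L(F) ≥ L(1) F(u)`.
-/

/-! ### Jensen's inequality for s.o.s-convex polynomials -/

/-- The substitution `h ↦ h(a + t(x - a))`, for fixed `a` and `t`. -/
noncomputable def lineSubst {σ : Type*} (a : σ → ℝ) (t : ℝ) :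
    MvPolynomial σ ℝ →ₐ[ℝ] MvPolynomial σ ℝ :=
  aeval fun i => C (a i) + C t * (X i - C (a i))

theorem totalDegree_aeval_le {σ τ : Type*} {f : σ → MvPolynomial τ ℝ}
    (hf : ∀ i, (f i).totalDegree ≤ 1) (h : MvPolynomial σ ℝ) :
    (aeval f h).totalDegree ≤ h.totalDegree := by
  conv_lhs => rw [h.as_sum, map_sum]
  refine totalDegree_finsetSum_le fun α hα => ?_
  rw [aeval_monomial]
  refine (totalDegree_mul _ _).trans ?_
  rw [MvPolynomial.algebraMap_eq, totalDegree_C, zero_add]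
  refine (totalDegree_finsetProd _ _).trans (le_trans ?_ (le_totalDegree hα))
  refine Finset.sum_le_sum fun i _ => (totalDegree_pow _ _).trans ?_
  simpa using Nat.mul_le_mul_left (α i) (hf i)

theorem totalDegree_X_sub_C_le {σ : Type*} (i : σ) (c : ℝ) :
    (X i - C c : MvPolynomial σ ℝ).totalDegree ≤ 1 := by
  refine (totalDegree_sub _ _).trans ?_
  simp

theorem totalDegree_lineSubst_le {σ : Type*} (a : σ → ℝ) (t : ℝ) (h : MvPolynomial σ ℝ) :
    (lineSubst a t h).totalDegree ≤ h.totalDegree := by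
  refine totalDegree_aeval_le (fun i => ?_) h
  refine (totalDegree_add _ _).trans (max_le (by simp) ?_)
  refine (totalDegree_mul _ _).trans ?_
  simpa using totalDegree_X_sub_C_le i (a i)

theorem pderiv_eq_zero_or_totalDegree_lt {σ : Type*} (i : σ) (h : MvPolynomial σ ℝ) :
    pderiv i h = 0 ∨ (pderiv i h).totalDegree + 1 ≤ h.totalDegree := by
  classical
  rcases Nat.eq_zero_or_pos h.totalDegree with h0 | hpos
  · left
    rw [totalDegree_eq_zero_iff_eq_C.1 h0, pderiv_C]
  · right
    suffices (pderiv i h).totalDegree ≤ h.totalDegree - 1 by omega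
    conv_lhs => rw [h.as_sum, map_sum]
    refine totalDegree_finsetSum_le fun α hα => ?_
    rw [pderiv_monomial]
    rcases Nat.eq_zero_or_pos (α i) with hi | hi
    · simp [hi]
    · refine (totalDegree_monomial_le _ _).trans ?_
      have h1 := le_totalDegree hα
      have h2 : (α - Finsupp.single i 1) + Finsupp.single i 1 = α := by
        ext j
        by_cases hj : i = j
        · subst hj; simp; omega
        · simp [hj]
      have h3 : (α - Finsupp.single i 1).degree + 1 = α.degree := by
        conv_rhs => rw [← h2, map_add, Finsupp.degree_single]
      change α.degree ≤ _ at h1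
      change (α - Finsupp.single i 1).degree ≤ _
      omega

theorem totalDegree_X_sub_C_mul_lineSubst_pderiv_le {σ : Type*} (a : σ → ℝ) (t : ℝ) (i j : σ)
    (h : MvPolynomial σ ℝ) :
    ((X i - C (a i)) * ((X j - C (a j)) * lineSubst a t (pderiv i (pderiv j h)))).totalDegree
      ≤ h.totalDegree := by
  rcases pderiv_eq_zero_or_totalDegree_lt i (pderiv j h) with h0 | h1
  · simp [h0]
  rcases pderiv_eq_zero_or_totalDegree_lt j h with h0 | h2
  · simp [h0]
  have h3 := totalDegree_mul (X i - C (a i))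
    ((X j - C (a j)) * lineSubst a t (pderiv i (pderiv j h)))
  have h4 := totalDegree_mul (X j - C (a j)) (lineSubst a t (pderiv i (pderiv j h)))
  have h5 := totalDegree_lineSubst_le a t (pderiv i (pderiv j h))
  have h6 := totalDegree_X_sub_C_le i (a i)
  have h7 := totalDegree_X_sub_C_le j (a j)
  omega

theorem map_C_mul {m : ℕ} (Λ : MvPolynomial (Fin m) ℝ →ₗ[ℝ] ℝ) (c : ℝ)
    (q : MvPolynomial (Fin m) ℝ) : Λ (C c * q) = c * Λ q := by
  rw [C_mul', map_smul, smul_eq_mul]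

/-- The chain rule along a line, under a linear functional. The factor `w` is what lets the
induction on `h` pass through products. -/
theorem hasDerivAt_lineSubst {m : ℕ} (Λ : MvPolynomial (Fin m) ℝ →ₗ[ℝ] ℝ) (a : Fin m → ℝ)
    (h w : MvPolynomial (Fin m) ℝ) (t : ℝ) :
    HasDerivAt (fun t => Λ (w * lineSubst a t h))
      (Λ (w * ∑ i, (X i - C (a i)) * lineSubst a t (pderiv i h))) t := by
  induction h using MvPolynomial.induction_on generalizing w with
  | C c => simpa [lineSubst] using hasDerivAt_const t _
  | add p q hp hq =>
    have e : (fun t => Λ (w * lineSubst a t (p + q))) =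
        fun t => Λ (w * lineSubst a t p) + Λ (w * lineSubst a t q) := by
      funext t; simp [mul_add]
    rw [e]
    refine ((hp w).fun_add (hq w)).congr_deriv ?_
    simp [mul_add, Finset.sum_add_distrib]
  | mul_X p j hp =>
    have key := (hp (w * C (a j))).fun_add
      ((hasDerivAt_id' t).fun_mul (hp (w * (X j - C (a j)))))
    have e : (fun t => Λ (w * lineSubst a t (p * X j))) = fun t =>
        Λ (w * C (a j) * lineSubst a t p) + t * Λ (w * (X j - C (a j)) * lineSubst a t p) := by
      funext s
      rw [← map_C_mul, ← map_add]
      congr 1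
      simp only [lineSubst, map_mul, aeval_X]
      ring
    rw [e]
    refine key.congr_deriv ?_
    rw [one_mul, ← map_C_mul, ← map_add, ← map_add]
    congr 1
    have e1 : ∀ i, lineSubst a t (pderiv i (p * X j)) =
        lineSubst a t (pderiv i p) * (C (a j) + C t * (X j - C (a j)))
          + (if i = j then lineSubst a t p else 0) := fun i => by
      rw [(pderiv i).leibniz, pderiv_X]
      by_cases hij : i = j
      · subst hij; simp [lineSubst]; ring
      · simp [lineSubst, hij, Ne.symm hij]; ring
    simp only [e1, mul_add, Finset.sum_add_distrib, mul_ite, mul_zero, Finset.sum_ite_eq',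
      Finset.mem_univ, if_true]
    simp only [← mul_assoc, ← Finset.sum_mul]
    ring

/-- **Jensen's inequality** for s.o.s-convex polynomials: `h (Λ x) ≤ Λ h` as soon as the linear
functional `Λ` has `Λ 1 = 1` and is nonnegative on the sums of squares of degree at most `D`,
where `D ≥ deg h`. Along the segment from `a = Λ x` the function `v(t) = Λ (h (a + t (x - a)))`
has `v' 0 = 0` and `v'' ≥ 0`, since `v'' t` is the value of `Λ` at a sum of squares. -/
theorem IsSosConvex.jensen {m D : ℕ} {h : MvPolynomial (Fin m) ℝ} (hh : IsSosConvex h)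
    (hD : h.totalDegree ≤ D) (Λ : MvPolynomial (Fin m) ℝ →ₗ[ℝ] ℝ) (h1 : Λ 1 = 1)
    (hpos : ∀ q, IsSumSq q → q.totalDegree ≤ D → 0 ≤ Λ q) :
    eval (fun i => Λ (X i)) h ≤ Λ h := by
  set a : Fin m → ℝ := fun i => Λ (X i) with ha
  have ΛC : ∀ c : ℝ, Λ (C c) = c := fun c => by simpa [h1] using map_C_mul Λ c 1
  have l0 : ∀ q, lineSubst a 0 q = C (eval a q) := fun q => by
    induction q using MvPolynomial.induction_on with
    | C c => simp [lineSubst]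
    | add p q hp hq => simp [hp, hq]
    | mul_X p j hp => rw [map_mul, hp]; simp [lineSubst]
  have l1 : lineSubst a 1 h = h := by simp [lineSubst]
  let v' : ℝ → ℝ := fun t => ∑ i, Λ ((X i - C (a i)) * lineSubst a t (pderiv i h))
  have hv : ∀ t, HasDerivAt (fun t => Λ (lineSubst a t h)) (v' t) t := fun t => by
    simpa [v'] using hasDerivAt_lineSubst Λ a h 1 t
  have hv' : ∀ t, HasDerivAt v' (∑ j, Λ ((X j - C (a j)) *
      ∑ i, (X i - C (a i)) * lineSubst a t (pderiv i (pderiv j h)))) t := fun t =>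
    HasDerivAt.fun_sum fun j _ => hasDerivAt_lineSubst Λ a (pderiv j h) (X j - C (a j)) t
  have hv'' : ∀ t, 0 ≤ ∑ j, Λ ((X j - C (a j)) *
      ∑ i, (X i - C (a i)) * lineSubst a t (pderiv i (pderiv j h))) := fun t => by
    rw [← map_sum]
    refine hpos _ ?_ ?_
    · obtain ⟨r, H, hH⟩ := hh
      have e : ∀ i j, pderiv i (pderiv j h) = ∑ k, H k i * H k j := fun i j => by
        have := congrFun (congrFun hH i) j
        simpa [Matrix.mul_apply] using this
      have : ∑ j, (X j - C (a j)) *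
          ∑ i, (X i - C (a i)) * lineSubst a t (pderiv i (pderiv j h)) =
          ∑ k, (∑ j, (X j - C (a j)) * lineSubst a t (H k j)) *
            (∑ j, (X j - C (a j)) * lineSubst a t (H k j)) := by
        simp only [e, map_sum, map_mul, Finset.mul_sum, Finset.sum_mul]
        calc _ = ∑ j, ∑ k, ∑ i, (X j - C (a j)) * ((X i - C (a i)) *
              (lineSubst a t (H k i) * lineSubst a t (H k j))) :=
              Finset.sum_congr rfl fun j _ => Finset.sum_comm
          _ = _ := by
              rw [Finset.sum_comm]
              refine Finset.sum_congr rfl fun k _ => Finset.sum_congr rfl fun j _ =>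
                Finset.sum_congr rfl fun i _ => by ring
      rw [this]
      exact IsSumSq.sum_mul_self _ _
    · refine totalDegree_finsetSum_le fun j _ => ?_
      rw [Finset.mul_sum]
      refine totalDegree_finsetSum_le fun i _ => le_trans ?_ hD
      have := totalDegree_X_sub_C_mul_lineSubst_pderiv_le a t i j h
      rwa [mul_left_comm] at this
  have hmono : Monotone v' := monotone_of_deriv_nonneg (fun t => (hv' t).differentiableAt)
    fun t => by rw [(hv' t).deriv]; exact hv'' t
  have h0 : v' 0 = 0 := by
    refine Finset.sum_eq_zero fun i _ => ?_
    rw [l0, mul_comm, map_C_mul, map_sub, ΛC]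
    simp [ha]
  have hv_mono : MonotoneOn (fun t => Λ (lineSubst a t h)) (Set.Ici 0) := by
    refine monotoneOn_of_deriv_nonneg (convex_Ici 0)
      (fun t _ => (hv t).continuousAt.continuousWithinAt)
      (fun t _ => (hv t).differentiableAt.differentiableWithinAt) fun t ht => ?_
    rw [(hv t).deriv, ← h0]
    rw [interior_Ici] at ht
    exact hmono (le_of_lt ht)
  have := hv_mono (Set.mem_Ici.2 le_rfl) (Set.mem_Ici.2 zero_le_one) zero_le_one
  simpa only [l0, l1, ΛC] using this

theorem IsSumSq.eval_nonneg {m : ℕ} {q : MvPolynomial (Fin m) ℝ} (hq : IsSumSq q)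
    (x : Fin m → ℝ) : 0 ≤ eval x q := by
  induction hq with
  | zero => simp
  | sq_add b _ ih =>
    rw [map_add, map_mul]
    exact add_nonneg (mul_self_nonneg _) ih

/-- Evaluation at a point, as a linear functional. -/
noncomputable def evalLin {m : ℕ} (x : Fin m → ℝ) : MvPolynomial (Fin m) ℝ →ₗ[ℝ] ℝ :=
  (aeval x).toLinearMap

@[simp]
theorem evalLin_apply {m : ℕ} (x : Fin m → ℝ) (q : MvPolynomial (Fin m) ℝ) :
    evalLin x q = eval x q := by
  change aeval x q = eval x q
  rw [aeval_eq_eval]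

/-- Jensen's inequality for the average of two point evaluations. -/
theorem IsSosConvex.eval_combo_le {m : ℕ} {h : MvPolynomial (Fin m) ℝ} (hh : IsSosConvex h)
    (x y : EuclideanSpace ℝ (Fin m)) {α β : ℝ} (hα : 0 ≤ α) (hβ : 0 ≤ β) (hαβ : α + β = 1) :
    eval (α • x + β • y).ofLp h ≤ α * eval x.ofLp h + β * eval y.ofLp h := by
  have key := hh.jensen le_rfl (α • evalLin x.ofLp + β • evalLin y.ofLp) (by simp [hαβ])
    fun q hq _ => by
      simpa using add_nonneg (mul_nonneg hα (hq.eval_nonneg x.ofLp))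
        (mul_nonneg hβ (hq.eval_nonneg y.ofLp))
  have e : (fun i => (α • evalLin x.ofLp + β • evalLin y.ofLp) (X i)) =
      (α • x + β • y).ofLp := by
    funext i; simp
  rw [e] at key
  simpa using key

theorem IsSosConvex.add {m : ℕ} {h k : MvPolynomial (Fin m) ℝ} (hh : IsSosConvex h)
    (hk : IsSosConvex k) : IsSosConvex (h + k) := by
  obtain ⟨r, H, hH⟩ := hh
  obtain ⟨t, K, hK⟩ := hk
  refine ⟨r + t, Matrix.of fun i j => Fin.addCases (fun i => H i j) (fun i => K i j) i, ?_⟩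
  ext1 i j
  have h1 := congrFun (congrFun hH i) j
  have h2 := congrFun (congrFun hK i) j
  simp only [Matrix.of_apply, Matrix.mul_apply, Matrix.transpose_apply] at h1 h2 ⊢
  rw [map_add, map_add, h1, h2, Fin.sum_univ_add]
  simp

theorem IsSosConvex.C_mul {m : ℕ} {h : MvPolynomial (Fin m) ℝ} (hh : IsSosConvex h) {c : ℝ}
    (hc : 0 ≤ c) : IsSosConvex (C c * h) := by
  obtain ⟨r, H, hH⟩ := hh
  refine ⟨r, Matrix.of fun i j => C (Real.sqrt c) * H i j, ?_⟩
  ext1 i j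
  have h1 := congrFun (congrFun hH i) j
  simp only [Matrix.of_apply, Matrix.mul_apply, Matrix.transpose_apply] at h1 ⊢
  rw [pderiv_C_mul, pderiv_C_mul, h1, Finset.mul_sum]
  refine Finset.sum_congr rfl fun k _ => ?_
  have : (C c : MvPolynomial (Fin m) ℝ) = C (Real.sqrt c) * C (Real.sqrt c) := by
    rw [← C.map_mul, Real.mul_self_sqrt hc]
  rw [this]
  ring

theorem isSosConvex_of_totalDegree_le_one {m : ℕ} {h : MvPolynomial (Fin m) ℝ}
    (hh : h.totalDegree ≤ 1) : IsSosConvex h := by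
  refine ⟨0, 0, ?_⟩
  ext1 i j
  rw [Matrix.mul_zero, Matrix.of_apply, Matrix.zero_apply]
  rcases pderiv_eq_zero_or_totalDegree_lt j h with h0 | h1
  · rw [h0, map_zero]
  · rcases pderiv_eq_zero_or_totalDegree_lt i (pderiv j h) with h2 | h2
    · exact h2
    · omega

/-! ### Needle polynomials -/

theorem totalDegree_polynomial_aeval_le {σ : Type*} (q : MvPolynomial σ ℝ) (p : Polynomial ℝ) :
    (Polynomial.aeval q p).totalDegree ≤ p.natDegree * q.totalDegree := by
  rw [Polynomial.aeval_eq_sum_range]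
  refine totalDegree_finsetSum_le fun i hi => (totalDegree_smul_le _ _).trans
    ((totalDegree_pow _ _).trans (Nat.mul_le_mul_right _ ?_))
  exact Nat.lt_succ_iff.1 (Finset.mem_range.1 hi)

/-- The scaling `1 / (2n + 1)`, which maps the squared distances `≤ 4n` in the cube `[-1,1]ⁿ`
into `[0, 2]`. -/
noncomputable def needleScale (n : ℕ) : ℝ := 1 / (2 * n + 1)

theorem needleScale_pos (n : ℕ) : 0 < needleScale n := by unfold needleScale; positivity

/-- The needle polynomial `T_r(1 + c (δ² - ‖y - y₀‖²))²`, where `T_r` is the Chebyshev polynomial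
and `c = needleScale n`. On the cube it is at most `1` at distance at least `δ` from `y₀`, and
exponentially large in `r δ` near `y₀`. -/
noncomputable def needle {n : ℕ} (r : ℕ) (δ : ℝ) (y₀ : EuclideanSpace ℝ (Fin n)) :
    MvPolynomial (Fin n) ℝ :=
  Polynomial.aeval (C (1 + needleScale n * δ ^ 2) - C (needleScale n) * ∑ i, (X i - C (y₀ i)) ^ 2)
    (Polynomial.Chebyshev.T ℝ r) ^ 2

theorem isSumSq_needle {n : ℕ} (r : ℕ) (δ : ℝ) (y₀ : EuclideanSpace ℝ (Fin n)) :
    IsSumSq (needle r δ y₀) := by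
  rw [needle, sq]
  exact IsSumSq.mul_self _

theorem totalDegree_needle_le {n : ℕ} (r : ℕ) (δ : ℝ) (y₀ : EuclideanSpace ℝ (Fin n)) :
    (needle r δ y₀).totalDegree ≤ 4 * r := by
  refine (totalDegree_pow _ _).trans ?_
  have h1 : (C (1 + needleScale n * δ ^ 2) - C (needleScale n) * ∑ i, (X i - C (y₀ i)) ^ 2 :
      MvPolynomial (Fin n) ℝ).totalDegree ≤ 2 := by
    refine (totalDegree_sub _ _).trans (max_le ((totalDegree_C _).trans_le (Nat.zero_le _)) ?_)
    refine (totalDegree_mul _ _).trans ?_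
    rw [totalDegree_C, zero_add]
    refine totalDegree_finsetSum_le fun i _ => (totalDegree_pow _ _).trans ?_
    have := totalDegree_X_sub_C_le i (y₀ i)
    omega
  have h2 := totalDegree_polynomial_aeval_le (C (1 + needleScale n * δ ^ 2) -
    C (needleScale n) * ∑ i, (X i - C (y₀ i)) ^ 2 : MvPolynomial (Fin n) ℝ)
    (Polynomial.Chebyshev.T ℝ r)
  rw [Polynomial.Chebyshev.natDegree_T, Int.natAbs_natCast] at h2
  have h3 := Nat.mul_le_mul_left r h1
  omega

theorem eval_needle {n : ℕ} (r : ℕ) (δ : ℝ) (y₀ y : EuclideanSpace ℝ (Fin n)) :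
    eval y.ofLp (needle r δ y₀) =
      (Polynomial.Chebyshev.T ℝ r).eval (1 + needleScale n * (δ ^ 2 - dist y y₀ ^ 2)) ^ 2 := by
  rw [needle, map_pow]
  congr 1
  have h : ∀ (q : MvPolynomial (Fin n) ℝ) (p : Polynomial ℝ),
      eval y.ofLp (Polynomial.aeval q p) = p.eval (eval y.ofLp q) := fun q p => by
    rw [Polynomial.aeval_def, Polynomial.hom_eval₂, Polynomial.eval]
    congr 1
    ext c
    simp
  rw [h]
  congr 1
  rw [EuclideanSpace.dist_eq, Real.sq_sqrt (by positivity)]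
  simp [Real.dist_eq]
  ring

theorem eval_needle_nonneg {n : ℕ} (r : ℕ) (δ : ℝ) (y₀ y : EuclideanSpace ℝ (Fin n)) :
    0 ≤ eval y.ofLp (needle r δ y₀) := by
  rw [eval_needle]
  positivity

theorem eval_needle_le_one {n : ℕ} (r : ℕ) {δ : ℝ} (hδ : 0 ≤ δ) {y₀ y : EuclideanSpace ℝ (Fin n)}
    (hy₀ : ∀ i, y₀ i ∈ Set.Icc (-1 : ℝ) 1) (hy : ∀ i, y i ∈ Set.Icc (-1 : ℝ) 1)
    (hd : δ ≤ dist y y₀) : eval y.ofLp (needle r δ y₀) ≤ 1 := by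
  rw [eval_needle, sq_le_one_iff_abs_le_one]
  refine Polynomial.Chebyshev.abs_eval_T_real_le_one _ (abs_le.2 ⟨?_, ?_⟩)
  · have h1 : dist y y₀ ^ 2 ≤ 4 * n := by
      rw [EuclideanSpace.dist_eq, Real.sq_sqrt (by positivity)]
      calc ∑ i, dist (y i) (y₀ i) ^ 2 ≤ ∑ _i : Fin n, (4 : ℝ) :=
            Finset.sum_le_sum fun i _ => by
              obtain ⟨h1, h2⟩ := hy₀ i
              obtain ⟨h3, h4⟩ := hy i
              rw [Real.dist_eq, sq_abs]
              nlinarith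
        _ = 4 * n := by simp [mul_comm]
    have h2 : needleScale n * (4 * n) ≤ 2 := by
      rw [needleScale, one_div, inv_mul_le_iff₀ (by positivity)]
      linarith
    have h3 := mul_le_mul_of_nonneg_left h1 (needleScale_pos n).le
    have h4 : 0 ≤ needleScale n * δ ^ 2 := mul_nonneg (needleScale_pos n).le (sq_nonneg δ)
    rw [mul_sub]
    linarith
  · have h1 : δ ^ 2 ≤ dist y y₀ ^ 2 := pow_le_pow_left₀ hδ hd 2
    nlinarith [needleScale_pos n]

theorem exp_le_eval_needle {n : ℕ} (r : ℕ) {δ : ℝ} (hδ : 0 ≤ δ)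
    {y₀ y : EuclideanSpace ℝ (Fin n)} (hsmall : Real.sqrt (needleScale n) / 2 * δ ≤ 1)
    (hd : dist y y₀ ≤ δ / 2) :
    Real.exp (2 * r * (Real.sqrt (needleScale n) / 2 * δ)) / 4 ≤
      eval y.ofLp (needle r δ y₀) := by
  set θ := Real.sqrt (needleScale n) / 2 * δ with hθ
  have hθ0 : 0 ≤ θ := by positivity
  set x := 1 + needleScale n * (δ ^ 2 - dist y y₀ ^ 2) with hx
  have hc := needleScale_pos n
  have hθ2 : θ ^ 2 = needleScale n * δ ^ 2 / 4 := by
    rw [hθ, mul_pow, div_pow, Real.sq_sqrt hc.le]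
    ring
  have hdist : dist y y₀ ^ 2 ≤ δ ^ 2 / 4 := by
    have := pow_le_pow_left₀ dist_nonneg hd 2
    linarith [div_pow δ 2 2]
  have hxθ : 1 + θ ^ 2 ≤ x := by
    rw [hx, hθ2]
    have h1 : δ ^ 2 / 4 ≤ δ ^ 2 - dist y y₀ ^ 2 := by nlinarith [sq_nonneg δ]
    have := mul_le_mul_of_nonneg_left h1 hc.le
    linarith
  have hcosh : Real.cosh θ ≤ x := by
    refine (Real.cosh_le_exp_half_sq θ).trans (le_trans ?_ hxθ)
    have h1 : |θ ^ 2 / 2| ≤ 1 := by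
      rw [abs_of_nonneg (by positivity)]
      nlinarith
    have h2 := Real.abs_exp_sub_one_le h1
    rw [abs_of_nonneg (by positivity : 0 ≤ θ ^ 2 / 2)] at h2
    linarith [le_abs_self (Real.exp (θ ^ 2 / 2) - 1)]
  have hx1 : 1 ≤ x := (Real.one_le_cosh θ).trans hcosh
  -- write `x = cosh a`, so that `T_r x = cosh (r a)`
  have hT : Real.exp (r * θ) / 2 ≤ (Polynomial.Chebyshev.T ℝ r).eval x := by
    rw [← Real.cosh_arcosh hx1] at hcosh ⊢
    rw [Polynomial.Chebyshev.T_real_cosh]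
    have h1 : θ ≤ |Real.arcosh x| := by
      simpa [abs_of_nonneg hθ0] using Real.cosh_le_cosh.1 hcosh
    have h2 : Real.cosh (r * θ) ≤ Real.cosh (((r : ℤ) : ℝ) * Real.arcosh x) := by
      rw [Real.cosh_le_cosh, abs_mul _ (Real.arcosh x),
        abs_of_nonneg (mul_nonneg (Nat.cast_nonneg r) hθ0)]
      simpa using mul_le_mul_of_nonneg_left h1 (Nat.cast_nonneg r)
    refine le_trans ?_ h2
    rw [Real.cosh_eq]
    have := Real.exp_pos (-(r * θ))
    linarith
  rw [eval_needle]
  have h3 := pow_le_pow_left₀ (by positivity) hT 2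
  refine le_trans (le_of_eq ?_) h3
  rw [div_pow, ← Real.exp_nat_mul]
  norm_num
  ring_nf

/-! ### The rate of convergence of the outer approximations of the nonnegative polynomials -/

theorem continuous_eval_ofLp {n : ℕ} (q : MvPolynomial (Fin n) ℝ) :
    Continuous fun y : EuclideanSpace ℝ (Fin n) => eval y.ofLp q :=
  (MvPolynomial.continuous_eval q).comp (PiLp.continuous_ofLp 2 _)

theorem isCompact_of_subset_cube {n : ℕ} {Y : Set (EuclideanSpace ℝ (Fin n))}
    (hcube : ∀ y ∈ Y, ∀ i, y i ∈ Set.Icc (-1 : ℝ) 1) (hclosed : IsClosed Y) : IsCompact Y := by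
  refine Metric.isCompact_of_isClosed_isBounded hclosed ?_
  refine (Metric.isBounded_iff_subset_closedBall (0 : EuclideanSpace ℝ (Fin n))).2
    ⟨Real.sqrt n, fun y hy => ?_⟩
  rw [mem_closedBall_zero_iff, EuclideanSpace.norm_eq]
  refine Real.sqrt_le_sqrt ?_
  calc ∑ i, ‖y i‖ ^ 2 ≤ ∑ _i : Fin n, (1 : ℝ) := Finset.sum_le_sum fun i _ => by
        rw [Real.norm_eq_abs, sq_le_one_iff_abs_le_one, abs_abs]
        exact abs_le.2 (hcube y hy i)
    _ = n := by simp

/-- Testing `ψ` against a needle at `y₀`: if `ψ(y₀)` is below `-2 Lip δ`, then the needle, which is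
large on the ball of radius `δ / 2`, forces this ball to have small volume in `Y`. -/
theorem needle_volume_bound {n : ℕ} {Y : Set (EuclideanSpace ℝ (Fin n))}
    (hcube : ∀ y ∈ Y, ∀ i, y i ∈ Set.Icc (-1 : ℝ) 1) (hclosed : IsClosed Y)
    {M Lip δ : ℝ} (hLip : 0 < Lip) (hδ : 0 < δ)
    (hsmall : Real.sqrt (needleScale n) / 2 * δ ≤ 1) {k r : ℕ} (hr : 4 * r ≤ 2 * k)
    {ψ : MvPolynomial (Fin n) ℝ} (hM : ∀ y ∈ Y, |eval y.ofLp ψ| ≤ M)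
    (hψ : ∀ y ∈ Y, ∀ z ∈ Y, |eval y.ofLp ψ - eval z.ofLp ψ| ≤ Lip * dist y z)
    (hint : ∀ σ : MvPolynomial (Fin n) ℝ, IsSumSq σ → σ.totalDegree ≤ 2 * k →
      0 ≤ ∫ y in Y, eval y.ofLp ψ * eval y.ofLp σ)
    {y₀ : EuclideanSpace ℝ (Fin n)} (hy₀ : y₀ ∈ Y) (hneg : eval y₀.ofLp ψ < -(2 * Lip * δ)) :
    Lip * δ * (Real.exp (2 * r * (Real.sqrt (needleScale n) / 2 * δ)) / 4) *
      volume.real (Metric.closedBall y₀ (δ / 2) ∩ Y) ≤ M * volume.real Y := by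
  set e := Real.exp (2 * r * (Real.sqrt (needleScale n) / 2 * δ)) / 4 with he
  have he0 : 0 < e := by positivity
  have hM0 : 0 ≤ M := (abs_nonneg _).trans (hM y₀ hy₀)
  have hc := isCompact_of_subset_cube hcube hclosed
  have hfin : volume Y ≠ ⊤ := hc.measure_lt_top.ne
  set B := Metric.closedBall y₀ (δ / 2) with hB
  have hBm : MeasurableSet B := Metric.isClosed_closedBall.measurableSet
  have hi1 : IntegrableOn (fun y : EuclideanSpace ℝ (Fin n) =>
      eval y.ofLp ψ * eval y.ofLp (needle r δ y₀)) Y :=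
    ((continuous_eval_ofLp ψ).mul (continuous_eval_ofLp _)).continuousOn.integrableOn_compact hc
  have hiM : IntegrableOn (fun _ : EuclideanSpace ℝ (Fin n) => M) Y := integrableOn_const hfin
  have hiB : IntegrableOn (B.indicator fun _ => Lip * δ * e) Y :=
    (integrableOn_const hfin).indicator hBm
  have hle : ∫ y in Y, eval y.ofLp ψ * eval y.ofLp (needle r δ y₀) ≤
      ∫ y in Y, (M - B.indicator (fun _ => Lip * δ * e) y) := by
    refine setIntegral_mono_on hi1 (hiM.sub hiB) hclosed.measurableSet fun y hy => ?_
    have hn0 := eval_needle_nonneg r δ y₀ y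
    have hlip : eval y.ofLp ψ ≤ eval y₀.ofLp ψ + Lip * dist y y₀ := by
      linarith [(abs_le.1 (hψ y hy y₀ hy₀)).2]
    by_cases hyB : y ∈ B
    · rw [Set.indicator_of_mem hyB]
      have hd : dist y y₀ ≤ δ / 2 := hyB
      have h1 := exp_le_eval_needle r hδ.le hsmall hd
      rw [← he] at h1
      have h2 : eval y.ofLp ψ ≤ -(Lip * δ) := by nlinarith
      have h3 : 0 < Lip * δ := by positivity
      nlinarith
    · rw [Set.indicator_of_notMem hyB, sub_zero]
      rcases le_total δ (dist y y₀) with hd | hd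
      · have h1 := eval_needle_le_one r hδ.le (hcube y₀ hy₀) (hcube y hy) hd
        have h2 := (abs_le.1 (hM y hy)).2
        nlinarith
      · have h2 : eval y.ofLp ψ ≤ 0 := by nlinarith
        exact (mul_nonpos_of_nonpos_of_nonneg h2 hn0).trans hM0
  have h0 := (hint _ (isSumSq_needle r δ y₀) ((totalDegree_needle_le r δ y₀).trans hr)).trans hle
  rw [integral_sub hiM hiB, setIntegral_const, setIntegral_indicator hBm, setIntegral_const,
    Set.inter_comm] at h0
  simp only [smul_eq_mul] at h0
  linarith

/-- If `Y` has lower volume density at all its points, then a polynomial `ψ` that has nonnegative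
integrals over `Y` against all sums of squares of degree at most `2k` is at least `-C log k / k`
on `Y`, with `C` depending on `ψ` only through a bound and a Lipschitz constant. A needle of degree
`2k` and width `δ` comparable to `log k / k` gains a factor `k^(n+2)` on a ball of volume
comparable to `δⁿ`. -/
theorem exists_rate_of_integral_nonneg {n : ℕ} {Y : Set (EuclideanSpace ℝ (Fin n))}
    (hcube : ∀ y ∈ Y, ∀ i, y i ∈ Set.Icc (-1 : ℝ) 1) (hclosed : IsClosed Y)
    (hDensity : ∃ ε η : ℝ, 0 < ε ∧ 0 < η ∧ ∀ y ∈ Y, ∀ δ : ℝ, 0 < δ → δ < ε →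
      ENNReal.ofReal η * volume (Metric.closedBall y δ) ≤ volume (Metric.closedBall y δ ∩ Y))
    (M : ℝ) {Lip : ℝ} (hLip : 0 < Lip) :
    ∃ A : ℝ, 0 < A ∧ ∀ᶠ k : ℕ in atTop, ∀ ψ : MvPolynomial (Fin n) ℝ,
      (∀ y ∈ Y, |eval y.ofLp ψ| ≤ M) →
      (∀ y ∈ Y, ∀ z ∈ Y, |eval y.ofLp ψ - eval z.ofLp ψ| ≤ Lip * dist y z) →
      (∀ σ : MvPolynomial (Fin n) ℝ, IsSumSq σ → σ.totalDegree ≤ 2 * k →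
        0 ≤ ∫ y in Y, eval y.ofLp ψ * eval y.ofLp σ) →
      ∀ y ∈ Y, -(A * (Real.log k / k)) ≤ eval y.ofLp ψ := by
  obtain ⟨ε, η, hε, hη, hdens⟩ := hDensity
  set κ := Real.sqrt (needleScale n) / 2 with hκ
  have hκ0 : 0 < κ := by
    have := Real.sqrt_pos.2 (needleScale_pos n)
    positivity
  set b := 2 * (n + 2) / κ with hb
  have hb0 : 0 < b := by positivity
  set ω := volume.real (Metric.ball (0 : EuclideanSpace ℝ (Fin n)) 1) with hω
  have hω0 : 0 < ω := ENNReal.toReal_pos (Metric.measure_ball_pos _ _ one_pos).ne'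
    measure_ball_lt_top.ne
  set Q := Lip * b / 4 * (η * ((b / 2) ^ n * ω)) with hQ
  have hQ0 : 0 < Q := by positivity
  have hlim : Tendsto (fun k : ℕ => b * (Real.log k / k)) atTop (nhds 0) := by
    have h1 : Tendsto (fun x : ℝ => Real.log x / x) atTop (nhds 0) := by
      simpa using Real.tendsto_pow_log_div_mul_add_atTop 1 0 1 one_ne_zero
    simpa using (h1.comp tendsto_natCast_atTop_atTop).const_mul b
  refine ⟨2 * Lip * b, by positivity, ?_⟩
  filter_upwards [eventually_ge_atTop 3, hlim.eventually_lt_const hε,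
    hlim.eventually_lt_const (inv_pos.2 hκ0),
    (tendsto_natCast_atTop_atTop (R := ℝ)).eventually_gt_atTop (M * volume.real Y / Q)]
    with k hk3 hkε hkκ hkQ ψ hM hψ hint y₀ hy₀
  by_contra! hneg
  set δ := b * (Real.log k / k) with hδ
  have hk3' : (3 : ℝ) ≤ k := by exact_mod_cast hk3
  have hk0 : (0 : ℝ) < k := by linarith
  have hlog : 1 ≤ Real.log k := by
    rw [Real.le_log_iff_exp_le hk0]
    linarith [Real.exp_one_lt_d9]
  have hbk : b / k ≤ δ := by
    rw [hδ, ← mul_div_assoc]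
    gcongr
    nlinarith
  have hδ0 : 0 < δ := lt_of_lt_of_le (by positivity) hbk
  have hsmall : κ * δ ≤ 1 := by
    have := mul_lt_mul_of_pos_left hkκ hκ0
    rw [mul_inv_cancel₀ hκ0.ne'] at this
    exact this.le
  have hvol := needle_volume_bound hcube hclosed hLip hδ0 hsmall (k := k) (r := k / 2) (by omega)
    hM hψ hint hy₀ (by rw [hδ]; linarith)
  -- the volume of the ball in `Y`
  have hball : η * ((δ / 2) ^ n * ω) ≤ volume.real (Metric.closedBall y₀ (δ / 2) ∩ Y) := by
    have h1 := hdens y₀ hy₀ (δ / 2) (by positivity) (by linarith)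
    have h2 := ENNReal.toReal_mono (measure_ne_top_of_subset Set.inter_subset_left
      measure_closedBall_lt_top.ne) h1
    rw [Measure.addHaar_closedBall _ _ (by positivity), ENNReal.toReal_mul, ENNReal.toReal_mul,
      ENNReal.toReal_ofReal hη.le, ENNReal.toReal_ofReal (by positivity),
      finrank_euclideanSpace_fin] at h2
    exact h2
  -- the gain of the needle
  have hexp : (k : ℝ) ^ (n + 2) ≤ Real.exp (2 * (k / 2 : ℕ) * (κ * δ)) := by
    have h1 : (k : ℝ) / 2 ≤ 2 * (k / 2 : ℕ) := by
      have h2 : k ≤ 2 * (2 * (k / 2)) := by omega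
      have h3 : (k : ℝ) ≤ 2 * (2 * (k / 2 : ℕ)) := by exact_mod_cast h2
      linarith
    have h2 : (k : ℝ) / 2 * (κ * δ) = (n + 2 : ℕ) * Real.log k := by
      rw [hδ, hb]
      push_cast
      field_simp
    have h3 : (k : ℝ) ^ (n + 2) = Real.exp ((k : ℝ) / 2 * (κ * δ)) := by
      rw [h2, Real.exp_nat_mul, Real.exp_log hk0]
    rw [h3]
    exact Real.exp_le_exp.2 (mul_le_mul_of_nonneg_right h1 (by positivity))
  have hfinal : Q * k ≤ M * volume.real Y := by
    refine le_trans ?_ hvol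
    have h1 : Lip * (b / k) * ((k : ℝ) ^ (n + 2) / 4) * (η * ((b / k / 2) ^ n * ω)) = Q * k := by
      rw [hQ, div_right_comm b, div_pow (b / 2), pow_add]
      field_simp
    rw [← h1]
    refine mul_le_mul ?_ (le_trans ?_ hball) (by positivity) (by positivity)
    · gcongr
    · gcongr
  rw [div_lt_iff₀ hQ0] at hkQ
  linarith

/-! ### Bounds on truncated pseudo-moments -/

/-- The linear functional `Λ` is nonnegative on the sums of squares of degree at most `2D`, and on
their products of degree at most `2D` with `R² - ‖x‖²`. -/
structure IsBallPseudoMoment {m : ℕ} (D : ℕ) (R : ℝ) (Λ : MvPolynomial (Fin m) ℝ →ₗ[ℝ] ℝ) :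
    Prop where
  sos_nonneg : ∀ q, IsSumSq q → q.totalDegree ≤ 2 * D → 0 ≤ Λ q
  ball_nonneg : ∀ σ, IsSumSq σ → σ.totalDegree ≤ 2 * (D - 1) → 0 ≤ Λ (FSIPP.ballPoly m R * σ)

namespace IsBallPseudoMoment

variable {m D : ℕ} {R : ℝ} {Λ : MvPolynomial (Fin m) ℝ →ₗ[ℝ] ℝ}

theorem one_nonneg (hΛ : IsBallPseudoMoment D R Λ) : 0 ≤ Λ 1 :=
  hΛ.sos_nonneg 1 IsSumSq.one (by simp)

theorem sum_X_sq_mul_le (hΛ : IsBallPseudoMoment D R Λ) {σ : MvPolynomial (Fin m) ℝ}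
    (hσ : IsSumSq σ) (hdeg : σ.totalDegree ≤ 2 * (D - 1)) :
    ∑ i, Λ (X i ^ 2 * σ) ≤ R ^ 2 * Λ σ := by
  have h := hΛ.ball_nonneg σ hσ hdeg
  rw [FSIPP.ballPoly, sub_mul, map_sub, map_C_mul, Finset.sum_mul, map_sum] at h
  linarith

/-- The ball constraint bounds the moment of `(x_i x^β)²` by `R²` times that of `(x^β)²`. -/
theorem even_moment_le (hΛ : IsBallPseudoMoment D R Λ) (α : Fin m →₀ ℕ) (hα : α.degree ≤ D) :
    Λ (monomial α 1 * monomial α 1) ≤ (1 + R ^ 2) ^ D * Λ 1 := by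
  suffices H : ∀ N, ∀ α : Fin m →₀ ℕ, α.degree = N → N ≤ D →
      Λ (monomial α 1 * monomial α 1) ≤ (1 + R ^ 2) ^ N * Λ 1 by
    refine (H _ α rfl hα).trans (mul_le_mul_of_nonneg_right ?_ hΛ.one_nonneg)
    exact pow_le_pow_right₀ (by nlinarith [sq_nonneg R]) hα
  intro N
  induction N with
  | zero =>
    intro α hα _
    rw [Finsupp.degree_eq_zero_iff] at hα
    subst hα
    simp
  | succ N ih =>
    intro α hα hN
    obtain ⟨i, hi⟩ : ∃ i, α i ≠ 0 := by
      by_contra! h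
      have : α = 0 := Finsupp.ext h
      simp [this] at hα
    set β := α - Finsupp.single i 1 with hβα
    have hsum : Finsupp.single i 1 + β = α :=
      add_tsub_cancel_of_le (Finsupp.single_le_iff.2 (Nat.one_le_iff_ne_zero.2 hi))
    have hβ : β.degree = N := by
      have := congrArg Finsupp.degree hsum
      rw [map_add, Finsupp.degree_single] at this
      omega
    have hα' : (monomial α (1 : ℝ)) = X i * monomial β 1 := by
      rw [← hsum, X, monomial_mul, one_mul]
    have hsq : IsSumSq (monomial β (1 : ℝ) * monomial β 1) := IsSumSq.mul_self _
    have hdegβ : (monomial β (1 : ℝ)).totalDegree ≤ N := by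
      refine (totalDegree_monomial_le _ _).trans ?_
      change β.degree ≤ N
      omega
    have hdeg : (monomial β (1 : ℝ) * monomial β 1).totalDegree ≤ 2 * N := by
      refine (totalDegree_mul _ _).trans ?_
      omega
    calc Λ (monomial α 1 * monomial α 1) = Λ (X i ^ 2 * (monomial β 1 * monomial β 1)) := by
          rw [hα']; congr 1; ring
      _ ≤ ∑ j, Λ (X j ^ 2 * (monomial β 1 * monomial β 1)) := by
          refine Finset.single_le_sum (f := fun j => Λ (X j ^ 2 * (monomial β 1 * monomial β 1)))
            (fun j _ => hΛ.sos_nonneg _ ?_ ?_) (Finset.mem_univ i)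
          · rw [sq]
            exact (IsSumSq.mul_self _).mul hsq
          · refine (totalDegree_mul _ _).trans ?_
            rw [totalDegree_X_pow]
            omega
      _ ≤ R ^ 2 * Λ (monomial β 1 * monomial β 1) := hΛ.sum_X_sq_mul_le hsq (by omega)
      _ ≤ (1 + R ^ 2) * ((1 + R ^ 2) ^ N * Λ 1) := by
          refine mul_le_mul (by linarith) (ih β hβ (by omega)) ?_ (by positivity)
          exact hΛ.sos_nonneg _ hsq (by omega)
      _ = (1 + R ^ 2) ^ (N + 1) * Λ 1 := by ring

/-- Splitting `x^α = x^β x^γ` with `β` and `γ` of degree at most `D` reduces the bound to even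
moments, by the positivity of `Λ` on the squares of `x^β ± x^γ`. -/
theorem abs_moment_le (hΛ : IsBallPseudoMoment D R Λ) (α : Fin m →₀ ℕ) (hα : α.degree ≤ 2 * D) :
    |Λ (monomial α 1)| ≤ (1 + R ^ 2) ^ D * Λ 1 := by
  obtain ⟨β, hβα, hβ⟩ := Finsupp.exists_le_degree_eq α (min α.degree D) (min_le_left _ _)
  set γ := α - β with hγ
  have hsum : γ + β = α := tsub_add_cancel_of_le hβα
  have hβD : β.degree ≤ D := by omega
  have hγD : γ.degree ≤ D := by
    have := congrArg Finsupp.degree hsum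
    rw [map_add] at this
    omega
  have e : (monomial α (1 : ℝ)) = monomial γ 1 * monomial β 1 := by
    rw [monomial_mul, one_mul, hsum]
  have h1 := hΛ.even_moment_le β hβD
  have h2 := hΛ.even_moment_le γ hγD
  have dβ : (monomial β (1 : ℝ)).totalDegree ≤ D := (totalDegree_monomial_le _ _).trans hβD
  have dγ : (monomial γ (1 : ℝ)).totalDegree ≤ D := (totalDegree_monomial_le _ _).trans hγD
  have h3 := hΛ.sos_nonneg _ (IsSumSq.mul_self (monomial γ (1 : ℝ) + monomial β 1)) <| by
    refine (totalDegree_mul _ _).trans ?_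
    have := (totalDegree_add (monomial γ (1 : ℝ)) (monomial β 1)).trans (max_le dγ dβ)
    omega
  have h4 := hΛ.sos_nonneg _ (IsSumSq.mul_self (monomial γ (1 : ℝ) - monomial β 1)) <| by
    refine (totalDegree_mul _ _).trans ?_
    have := (totalDegree_sub (monomial γ (1 : ℝ)) (monomial β 1)).trans (max_le dγ dβ)
    omega
  have e3 : (monomial γ (1 : ℝ) + monomial β 1) * (monomial γ (1 : ℝ) + monomial β 1) =
      monomial γ 1 * monomial γ 1 + monomial β 1 * monomial β 1 + (2 : ℝ) • monomial α 1 := by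
    rw [e, two_smul]; ring
  have e4 : (monomial γ (1 : ℝ) - monomial β 1) * (monomial γ (1 : ℝ) - monomial β 1) =
      monomial γ 1 * monomial γ 1 + monomial β 1 * monomial β 1 - (2 : ℝ) • monomial α 1 := by
    rw [e, two_smul]; ring
  rw [e3, map_add, map_add, map_smul, smul_eq_mul] at h3
  rw [e4, map_sub, map_add, map_smul, smul_eq_mul] at h4
  exact abs_le.2 ⟨by linarith, by linarith⟩

theorem abs_map_le (hΛ : IsBallPseudoMoment D R Λ) {q : MvPolynomial (Fin m) ℝ}
    (hq : q.totalDegree ≤ 2 * D) :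
    |Λ q| ≤ (∑ α ∈ q.support, |q.coeff α|) * ((1 + R ^ 2) ^ D * Λ 1) := by
  conv_lhs => rw [q.as_sum, map_sum]
  rw [Finset.sum_mul]
  refine (Finset.abs_sum_le_sum_abs _ _).trans (Finset.sum_le_sum fun α hα => ?_)
  have e : monomial α (q.coeff α) = C (q.coeff α) * monomial α 1 := by
    rw [C_mul_monomial, mul_one]
  rw [e, map_C_mul, abs_mul]
  refine mul_le_mul_of_nonneg_left (hΛ.abs_moment_le α ?_) (abs_nonneg _)
  exact (le_totalDegree hα).trans hq

/-- The vector of the first moments lies in the ball of radius `R`. -/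
theorem norm_le (hΛ : IsBallPseudoMoment D R Λ) (hD : 1 ≤ D) (hR : 0 ≤ R) (h1 : Λ 1 = 1)
    (u : EuclideanSpace ℝ (Fin m)) (hu : ∀ i, u i = Λ (X i)) : ‖u‖ ≤ R := by
  rw [EuclideanSpace.norm_eq, Real.sqrt_le_left hR]
  have h := hΛ.sum_X_sq_mul_le (IsSumSq.one) (by simp)
  simp only [mul_one, h1] at h
  refine le_trans (Finset.sum_le_sum fun i _ => ?_) h
  have h2 := hΛ.sos_nonneg _ (IsSumSq.mul_self (X i - C (u i))) <| by
    refine (totalDegree_mul _ _).trans ?_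
    have := totalDegree_X_sub_C_le i (u i)
    omega
  have e : (X i - C (u i) : MvPolynomial (Fin m) ℝ) * (X i - C (u i)) =
      X i ^ 2 - C (2 * u i) * X i + C (u i ^ 2) * 1 := by
    rw [C_mul, C_pow, map_ofNat C]; ring
  rw [e, map_add, map_sub, map_C_mul, map_C_mul, h1, ← hu i] at h2
  rw [Real.norm_eq_abs, sq_abs]
  linarith

theorem smul (hΛ : IsBallPseudoMoment D R Λ) {c : ℝ} (hc : 0 ≤ c) :
    IsBallPseudoMoment D R (c • Λ) :=
  ⟨fun q h1 h2 => mul_nonneg hc (hΛ.sos_nonneg q h1 h2),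
    fun σ h1 h2 => mul_nonneg hc (hΛ.ball_nonneg σ h1 h2)⟩

end IsBallPseudoMoment

theorem totalDegree_ballPoly_le (m : ℕ) (R : ℝ) : (FSIPP.ballPoly m R).totalDegree ≤ 2 := by
  refine (totalDegree_sub _ _).trans (max_le ((totalDegree_C _).trans_le (Nat.zero_le _)) ?_)
  exact totalDegree_finsetSum_le fun i _ => (totalDegree_X_pow i 2).le

/-! ### Uniform bounds for families of polynomials on a compact set -/

theorem exists_bound_lipschitz_eval {n : ℕ} {Y : Set (EuclideanSpace ℝ (Fin n))}
    (hY : IsCompact Y) (q : MvPolynomial (Fin n) ℝ) : ∃ M : ℝ, 0 ≤ M ∧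
      (∀ y ∈ Y, |eval y.ofLp q| ≤ M) ∧
      ∀ y ∈ Y, ∀ z ∈ Y, |eval y.ofLp q - eval z.ofLp q| ≤ M * dist y z := by
  obtain ⟨M₁, hM₁⟩ := hY.exists_bound_of_continuousOn (continuous_eval_ofLp q).continuousOn
  have hd : ContDiff ℝ 1 fun y : EuclideanSpace ℝ (Fin n) => eval y.ofLp q :=
    (AnalyticOnNhd.eval_continuousLinearMap
      (EuclideanSpace.equiv (Fin n) ℝ : EuclideanSpace ℝ (Fin n) →L[ℝ] (Fin n → ℝ)) q).contDiff
  obtain ⟨M₂, hM₂⟩ := (hd.locallyLipschitz.locallyLipschitzOn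
    (s := Y)).exists_lipschitzOnWith_of_compact hY
  refine ⟨max M₁ M₂, le_max_of_le_right M₂.2, fun y hy => (hM₁ y hy).trans (le_max_left _ _),
    fun y hy z hz => ?_⟩
  refine (hM₂.dist_le_mul y hy z hz).trans ?_
  exact mul_le_mul_of_nonneg_right (le_max_right _ _) dist_nonneg

/-- The linear combinations of fixed polynomials with bounded coefficients share one bound and one
Lipschitz constant on a compact set. -/
theorem exists_bound_lipschitz_eval_sum {n : ℕ} {ι : Type*} {Y : Set (EuclideanSpace ℝ (Fin n))}
    (hY : IsCompact Y) (s : Finset ι) (q : ι → MvPolynomial (Fin n) ℝ) {B : ℝ} (hB : 0 ≤ B) :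
    ∃ M : ℝ, 0 ≤ M ∧ ∀ c : ι → ℝ, (∀ i ∈ s, |c i| ≤ B) →
      (∀ y ∈ Y, |eval y.ofLp (∑ i ∈ s, c i • q i)| ≤ M) ∧
      ∀ y ∈ Y, ∀ z ∈ Y, |eval y.ofLp (∑ i ∈ s, c i • q i) - eval z.ofLp (∑ i ∈ s, c i • q i)| ≤
        M * dist y z := by
  choose M hM0 hM1 hM2 using fun i => exists_bound_lipschitz_eval hY (q i)
  refine ⟨∑ i ∈ s, B * M i, Finset.sum_nonneg fun i _ => mul_nonneg hB (hM0 i), fun c hc =>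
    ⟨fun y hy => ?_, fun y hy z hz => ?_⟩⟩
  · rw [map_sum]
    refine (Finset.abs_sum_le_sum_abs _ _).trans (Finset.sum_le_sum fun i hi => ?_)
    rw [smul_eval, abs_mul]
    exact mul_le_mul (hc i hi) (hM1 i y hy) (abs_nonneg _) hB
  · rw [map_sum, map_sum, ← Finset.sum_sub_distrib, Finset.sum_mul]
    refine (Finset.abs_sum_le_sum_abs _ _).trans (Finset.sum_le_sum fun i hi => ?_)
    rw [smul_eval, smul_eval, ← mul_sub, abs_mul, mul_assoc]
    exact mul_le_mul (hc i hi) (hM2 i y hy z hz) (abs_nonneg _) hB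

/-! ### The functionals of the relaxations -/

namespace FSIPP

variable {m n s : ℕ} (P : FSIPP m n s)

theorem totalDegree_pAt_le (y : EuclideanSpace ℝ (Fin n)) : (P.pAt y).totalDegree ≤ 2 * P.d := by
  refine le_trans (Finset.sup_mono (support_map_subset _ _)) ?_
  exact ((le_max_right _ _).trans (le_max_right _ _)).trans P.maxDeg_le

/-- `Λ` extends `L` from the polynomials of degree at most `2d` to all polynomials. -/
def Extends (Λ : MvPolynomial (Fin m) ℝ →ₗ[ℝ] ℝ) (L : Module.Dual ℝ P.polyX) : Prop :=
  ∀ q : P.polyX, L q = Λ q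

theorem exists_extends (L : Module.Dual ℝ P.polyX) : ∃ Λ, P.Extends Λ L := by
  obtain ⟨Λ, hΛ⟩ := LinearMap.exists_extend L
  exact ⟨Λ, fun q => by rw [← hΛ]; rfl⟩

variable {P}

theorem Extends.applyP_eq {Λ : MvPolynomial (Fin m) ℝ →ₗ[ℝ] ℝ} {L : Module.Dual ℝ P.polyX}
    (h : P.Extends Λ L) :
    P.applyP L = ∑ α ∈ P.p.support, Λ (monomial α 1) • P.p.coeff α := by
  rw [applyP, ← Finset.sum_attach P.p.support]
  exact Finset.sum_congr rfl fun α _ => by rw [h]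

theorem Extends.eval_applyP {Λ : MvPolynomial (Fin m) ℝ →ₗ[ℝ] ℝ} {L : Module.Dual ℝ P.polyX}
    (h : P.Extends Λ L) (y : EuclideanSpace ℝ (Fin n)) :
    eval y.ofLp (P.applyP L) = Λ (P.pAt y) := by
  rw [h.applyP_eq, map_sum, pAt]
  conv_rhs => rw [P.p.as_sum, map_sum, map_sum]
  refine Finset.sum_congr rfl fun α _ => ?_
  have e : monomial α (eval y.ofLp (P.p.coeff α)) =
      C (eval y.ofLp (P.p.coeff α)) * monomial α (1 : ℝ) := by
    rw [C_mul_monomial, mul_one]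
  rw [smul_eval, map_monomial, e, map_C_mul, mul_comm]

theorem totalDegree_applyP_le (L : Module.Dual ℝ P.polyX) :
    (P.applyP L).totalDegree ≤ P.degY :=
  totalDegree_finsetSum_le fun α _ => (totalDegree_smul_le _ _).trans
    (Finset.le_sup (f := fun α => (P.p.coeff α).totalDegree) α.2)

theorem continuous_eval_pAt (x : EuclideanSpace ℝ (Fin m)) :
    Continuous fun y => eval x.ofLp (P.pAt y) := by
  have h : P.Extends (evalLin x.ofLp) ((evalLin x.ofLp).comp P.polyX.subtype) := fun q => rfl
  have e : (fun y => eval x.ofLp (P.pAt y)) = fun y : EuclideanSpace ℝ (Fin n) =>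
      eval y.ofLp (P.applyP ((evalLin x.ofLp).comp P.polyX.subtype)) := by
    funext y
    rw [h.eval_applyP, evalLin_apply]
  rw [e]
  exact continuous_eval_ofLp _

theorem Extends.isBallPseudoMoment {Λ : MvPolynomial (Fin m) ℝ →ₗ[ℝ] ℝ}
    {L : Module.Dual ℝ P.polyX} (h : P.Extends Λ L) (hd : 1 ≤ P.d) {R : ℝ} {k : ℕ}
    (hL : L ∈ P.outerFeasible R k) : IsBallPseudoMoment P.d R Λ where
  sos_nonneg q hq hdeg := by
    have := hL.1 ⟨q, (mem_restrictTotalDegree _ _ _).2 hdeg⟩ hq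
    rwa [h] at this
  ball_nonneg σ hσ hdeg := by
    have hmem : ballPoly m R * σ ∈ P.polyX := by
      refine (mem_restrictTotalDegree _ _ _).2 ((totalDegree_mul _ _).trans ?_)
      have := totalDegree_ballPoly_le m R
      omega
    have := hL.2.1 ⟨_, hmem⟩ ⟨σ, hσ, hdeg, rfl⟩
    rwa [h] at this

/-- The functionals that define `Λ_k` violate the semi-infinite constraint by `O(log k / k)` at
most, uniformly. -/
theorem exists_rate_outerFeasible (hd : 1 ≤ P.d) (R : ℝ)
    (hYcube : ∀ y ∈ P.Y, ∀ i, y i ∈ Set.Icc (-1 : ℝ) 1) (hYclosed : IsClosed P.Y)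
    (hDensity : ∃ ε η : ℝ, 0 < ε ∧ 0 < η ∧ ∀ y ∈ P.Y, ∀ δ : ℝ, 0 < δ → δ < ε →
      ENNReal.ofReal η * volume (Metric.closedBall y δ) ≤ volume (Metric.closedBall y δ ∩ P.Y)) :
    ∃ A : ℝ, 0 < A ∧ ∀ᶠ k : ℕ in atTop, ∀ L ∈ P.outerFeasible R k, ∀ Λ, P.Extends Λ L →
      ∀ y ∈ P.Y, Λ (P.pAt y) ≤ A * (Real.log k / k) := by
  obtain ⟨M, hM0, hM⟩ := exists_bound_lipschitz_eval_sum
    (isCompact_of_subset_cube hYcube hYclosed) P.p.support (fun α => P.p.coeff α)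
    (B := (1 + R ^ 2) ^ P.d) (by positivity)
  obtain ⟨A, hA, hk⟩ := exists_rate_of_integral_nonneg hYcube hYclosed hDensity M
    (Lip := M + 1) (by linarith)
  refine ⟨A, hA, hk.mono fun k hk L hL Λ h y hy => ?_⟩
  have h1 : Λ 1 = 1 := by rw [← hL.2.2.2.1, h]
  have hΛ := h.isBallPseudoMoment hd hL
  have e : -P.applyP L = ∑ α ∈ P.p.support, (-Λ (monomial α 1)) • P.p.coeff α := by
    rw [h.applyP_eq, ← Finset.sum_neg_distrib]
    exact Finset.sum_congr rfl fun α _ => (neg_smul _ _).symm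
  obtain ⟨hb, hlip⟩ := hM (fun α => -Λ (monomial α 1)) fun α hα => by
    rw [abs_neg]
    have hdeg : α.degree ≤ 2 * P.d := (le_totalDegree hα).trans
      (((le_max_right _ _).trans (le_max_right _ _)).trans P.maxDeg_le)
    simpa [h1] using hΛ.abs_moment_le α hdeg
  rw [← e] at hb hlip
  have := hk (-P.applyP L) hb (fun y hy z hz => (hlip y hy z hz).trans
    (mul_le_mul_of_nonneg_right (by linarith) dist_nonneg)) hL.2.2.1.2 y hy
  rw [map_neg, h.eval_applyP] at this
  linarith

end FSIPP

/-! ### Normalization of dual feasible functionals -/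

namespace FSIPP

variable {m n s : ℕ} {P : FSIPP m n s}

theorem smul_mem_outerCone {ψ : MvPolynomial (Fin n) ℝ} {k : ℕ} (hψ : ψ ∈ P.outerCone k) {c : ℝ}
    (hc : 0 ≤ c) : c • ψ ∈ P.outerCone k := by
  refine ⟨(totalDegree_smul_le _ _).trans hψ.1, fun σ hσ hdeg => ?_⟩
  simp only [smul_eval, mul_assoc]
  rw [integral_const_mul]
  exact mul_nonneg hc (hψ.2 σ hσ hdeg)

theorem applyP_smul (c : ℝ) (L : Module.Dual ℝ P.polyX) : P.applyP (c • L) = c • P.applyP L := by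
  rw [applyP, applyP, Finset.smul_sum]
  exact Finset.sum_congr rfl fun α _ => by rw [LinearMap.smul_apply, smul_eq_mul, mul_smul]

theorem Extends.smul {Λ : MvPolynomial (Fin m) ℝ →ₗ[ℝ] ℝ} {L : Module.Dual ℝ P.polyX}
    (h : P.Extends Λ L) (c : ℝ) : P.Extends (c • Λ) (c • L) := fun q => by
  rw [LinearMap.smul_apply, LinearMap.smul_apply, h]

theorem Extends.isBallPseudoMoment_of_dualFeasible {Λ : MvPolynomial (Fin m) ℝ →ₗ[ℝ] ℝ}
    {L : Module.Dual ℝ P.polyX} (h : P.Extends Λ L) (hd : 1 ≤ P.d) {R gStar : ℝ} {k : ℕ}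
    (hL : L ∈ P.dualFeasible R gStar k) : IsBallPseudoMoment P.d R Λ where
  sos_nonneg q hq hdeg := by
    have := hL.1 ⟨q, (mem_restrictTotalDegree _ _ _).2 hdeg⟩
      ⟨q, 0, 0, hq, .zero, .zero, hdeg, by simp, by simp, by simp⟩
    rwa [h] at this
  ball_nonneg σ hσ hdeg := by
    have hdeg' : (σ * ballPoly m R).totalDegree ≤ 2 * P.d := by
      refine (totalDegree_mul _ _).trans ?_
      have := totalDegree_ballPoly_le m R
      omega
    have := hL.1 ⟨σ * ballPoly m R, (mem_restrictTotalDegree _ _ _).2 hdeg'⟩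
      ⟨0, σ, 0, .zero, hσ, .zero, by simp, hdeg', by simp, by simp⟩
    rw [h] at this
    rwa [mul_comm]

/-- If `Λ 1` were zero, the bounds on pseudo-moments would give `Λ g = 0`. -/
theorem Extends.map_one_pos {Λ : MvPolynomial (Fin m) ℝ →ₗ[ℝ] ℝ}
    {L : Module.Dual ℝ P.polyX} (h : P.Extends Λ L) (hd : 1 ≤ P.d) {R gStar : ℝ} {k : ℕ}
    (hL : L ∈ P.dualFeasible R gStar k) : 0 < Λ 1 := by
  have hΛ := h.isBallPseudoMoment_of_dualFeasible hd hL
  refine lt_of_le_of_ne hΛ.one_nonneg fun h0 => ?_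
  have h1 := hΛ.abs_map_le ((mem_restrictTotalDegree _ _ _).1 P.g_mem)
  have h2 : Λ P.g = 1 := (h ⟨P.g, P.g_mem⟩).symm.trans hL.2.1
  rw [← h0, h2] at h1
  norm_num at h1

theorem Extends.map_one_le {Λ : MvPolynomial (Fin m) ℝ →ₗ[ℝ] ℝ}
    {L : Module.Dual ℝ P.polyX} (h : P.Extends Λ L) {R gStar : ℝ} (hg : 0 < gStar) {k : ℕ}
    (hL : L ∈ P.dualFeasible R gStar k) : Λ 1 ≤ 1 / gStar := by
  have hdeg : (P.g - C gStar).totalDegree ≤ 2 * P.d := by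
    refine (totalDegree_sub _ _).trans (max_le ((mem_restrictTotalDegree _ _ _).1 P.g_mem) ?_)
    exact (totalDegree_C _).trans_le (Nat.zero_le _)
  have h1 := hL.1 ⟨P.g - C gStar, (mem_restrictTotalDegree _ _ _).2 hdeg⟩
    ⟨0, 0, 1, .zero, .zero, .one, by simp, by simp, by simpa using hdeg, by simp⟩
  have h2 : Λ P.g = 1 := (h ⟨P.g, P.g_mem⟩).symm.trans hL.2.1
  have h3 := map_C_mul Λ gStar 1
  rw [mul_one] at h3
  rw [h, map_sub, h2, h3] at h1
  rw [le_div_iff₀ hg]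
  linarith

/-- A feasible point of the dual relaxation becomes, after normalization, one of the functionals
that define `Λ_k`. -/
theorem Extends.normalize_mem {Λ : MvPolynomial (Fin m) ℝ →ₗ[ℝ] ℝ}
    {L : Module.Dual ℝ P.polyX} (h : P.Extends Λ L) (hd : 1 ≤ P.d) {R gStar : ℝ} {k : ℕ}
    (hL : L ∈ P.dualFeasible R gStar k) : (Λ 1)⁻¹ • L ∈ P.outerFeasible R k := by
  have hΛ := h.isBallPseudoMoment_of_dualFeasible hd hL
  have hpos := h.map_one_pos hd hL
  have hc : 0 ≤ (Λ 1)⁻¹ := (inv_pos.2 hpos).le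
  refine ⟨fun q hq => ?_, fun q hq => ?_, ?_, ?_, fun j => ?_⟩
  · rw [LinearMap.smul_apply, h]
    exact mul_nonneg hc (hΛ.sos_nonneg _ hq ((mem_restrictTotalDegree _ _ _).1 q.2))
  · obtain ⟨σ, hσ, hdeg, e⟩ := hq
    rw [LinearMap.smul_apply, h, e]
    exact mul_nonneg hc (hΛ.ball_nonneg _ hσ hdeg)
  · rw [applyP_smul, ← smul_neg]
    exact smul_mem_outerCone hL.2.2.1 hc
  · rw [LinearMap.smul_apply, h, smul_eq_mul]
    exact inv_mul_cancel₀ hpos.ne'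
  · rw [LinearMap.smul_apply]
    exact mul_nonpos_of_nonneg_of_nonpos hc (hL.2.2.2 j)

/-- Jensen's inequality for the functionals that define `Λ_k`. -/
theorem Extends.jensen {Λ : MvPolynomial (Fin m) ℝ →ₗ[ℝ] ℝ}
    {L : Module.Dual ℝ P.polyX} (h : P.Extends Λ L) (hd : 1 ≤ P.d) {R : ℝ} {k : ℕ}
    (hL : L ∈ P.outerFeasible R k) {u : EuclideanSpace ℝ (Fin m)} (hu : ∀ i, u i = Λ (X i))
    {q : MvPolynomial (Fin m) ℝ} (hq : IsSosConvex q) (hdeg : q.totalDegree ≤ 2 * P.d) :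
    eval u.ofLp q ≤ Λ q := by
  have e : u.ofLp = fun i => Λ (X i) := funext hu
  rw [e]
  exact hq.jensen hdeg Λ (by rw [← hL.2.2.2.1, h]) (h.isBallPseudoMoment hd hL).sos_nonneg

/-! ### Slater points and the correction of almost feasible points -/

/-- Between an arbitrary Slater point and a feasible point in the open ball there is a Slater
point in the ball. -/
theorem exists_slater_in_ball {R : ℝ} (hYc : IsCompact P.Y)
    (hφ : ∀ j, IsSosConvex (P.φ j)) (hp : ∀ y ∈ P.Y, IsSosConvex (P.pAt y))
    {v : EuclideanSpace ℝ (Fin m)} (hv : v ∈ P.K) (hvR : ‖v‖ < R)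
    {u : EuclideanSpace ℝ (Fin m)} (hu : u ∈ P.K)
    (hslater : ∀ y ∈ P.Y, eval u.ofLp (P.pAt y) < 0) :
    ∃ z ∈ P.K, ‖z‖ ≤ R ∧ ∃ c : ℝ, 0 < c ∧ ∀ y ∈ P.Y, eval z.ofLp (P.pAt y) ≤ -c := by
  have hR : 0 < R := (norm_nonneg v).trans_lt hvR
  have hu0 := norm_nonneg u
  have hden : 0 < R - ‖v‖ + ‖u‖ := by linarith
  set α := ‖u‖ / (R - ‖v‖ + ‖u‖) with hα
  set β := (R - ‖v‖) / (R - ‖v‖ + ‖u‖) with hβ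
  have hα0 : 0 ≤ α := by positivity
  have hβ0 : 0 < β := div_pos (by linarith) hden
  have hαβ : α + β = 1 := by rw [hα, hβ]; field_simp; ring
  set z := α • v + β • u with hz
  have hzneg : ∀ y ∈ P.Y, eval z.ofLp (P.pAt y) < 0 := fun y hy => by
    have h1 := (hp y hy).eval_combo_le v u hα0 hβ0.le hαβ
    have h2 := hv.2 y hy
    have h3 := hslater y hy
    have h4 := mul_nonpos_of_nonneg_of_nonpos hα0 h2
    have h5 := mul_neg_of_pos_of_neg hβ0 h3
    linarith
  refine ⟨z, ⟨fun j => ?_, fun y hy => (hzneg y hy).le⟩, ?_, ?_⟩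
  · have h1 := (hφ j).eval_combo_le v u hα0 hβ0.le hαβ
    have h4 := mul_nonpos_of_nonneg_of_nonpos hα0 (hv.1 j)
    have h5 := mul_nonpos_of_nonneg_of_nonpos hβ0.le (hu.1 j)
    linarith
  · calc ‖z‖ ≤ α * ‖v‖ + β * ‖u‖ := by
          refine (norm_add_le _ _).trans_eq ?_
          rw [norm_smul, norm_smul, Real.norm_of_nonneg hα0, Real.norm_of_nonneg hβ0.le]
      _ = R * ‖u‖ / (R - ‖v‖ + ‖u‖) := by rw [hα, hβ]; field_simp; ring
      _ ≤ R := by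
          rw [div_le_iff₀ hden]
          nlinarith
  · rcases P.Y.eq_empty_or_nonempty with hY | hY
    · exact ⟨1, one_pos, by simp [hY]⟩
    · obtain ⟨y₁, hy₁, hmax⟩ := hYc.exists_isMaxOn hY (continuous_eval_pAt z).continuousOn
      exact ⟨-eval z.ofLp (P.pAt y₁), neg_pos.2 (hzneg y₁ hy₁), fun y hy => by
        rw [neg_neg]; exact hmax hy⟩

/-- Moving a point that violates the semi-infinite constraint by at most `ε` towards a Slater point
`z` with slack `c` makes it feasible. -/
theorem combo_mem_K {R ε c : ℝ} (hε : 0 ≤ ε) (hc : 0 < c)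
    (hφ : ∀ j, IsSosConvex (P.φ j)) (hp : ∀ y ∈ P.Y, IsSosConvex (P.pAt y))
    {z : EuclideanSpace ℝ (Fin m)} (hz : z ∈ P.K) (hzR : ‖z‖ ≤ R)
    (hzc : ∀ y ∈ P.Y, eval z.ofLp (P.pAt y) ≤ -c)
    {u : EuclideanSpace ℝ (Fin m)} (huR : ‖u‖ ≤ R) (huφ : ∀ j, eval u.ofLp (P.φ j) ≤ 0)
    (hup : ∀ y ∈ P.Y, eval u.ofLp (P.pAt y) ≤ ε) :
    (c / (c + ε)) • u + (ε / (c + ε)) • z ∈ P.K ∩ Metric.closedBall 0 R := by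
  have hden : 0 < c + ε := by linarith
  have hα0 : 0 ≤ c / (c + ε) := by positivity
  have hβ0 : 0 ≤ ε / (c + ε) := by positivity
  have hαβ : c / (c + ε) + ε / (c + ε) = 1 := by field_simp
  refine ⟨⟨fun j => ?_, fun y hy => ?_⟩, ?_⟩
  · have h1 := (hφ j).eval_combo_le u z hα0 hβ0 hαβ
    have h2 := mul_nonpos_of_nonneg_of_nonpos hα0 (huφ j)
    have h3 := mul_nonpos_of_nonneg_of_nonpos hβ0 (hz.1 j)
    linarith
  · refine ((hp y hy).eval_combo_le u z hα0 hβ0 hαβ).trans ?_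
    have h2 := mul_le_mul_of_nonneg_left (hup y hy) hα0
    have h3 := mul_le_mul_of_nonneg_left (hzc y hy) hβ0
    have h4 : c / (c + ε) * ε + ε / (c + ε) * -c = 0 := by field_simp; ring
    linarith
  · exact (convex_closedBall (0 : EuclideanSpace ℝ (Fin m)) R)
      (mem_closedBall_zero_iff.2 huR) (mem_closedBall_zero_iff.2 hzR) hα0 hβ0 hαβ

/-- A point of the ball that violates only the semi-infinite constraint, by at most `ε`, has
distance `O(ε)` from the feasible points of the ball. -/
theorem infDist_le_of_violation_le {R ε c : ℝ} (hε : 0 ≤ ε) (hc : 0 < c)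
    (hφ : ∀ j, IsSosConvex (P.φ j)) (hp : ∀ y ∈ P.Y, IsSosConvex (P.pAt y))
    {z : EuclideanSpace ℝ (Fin m)} (hz : z ∈ P.K) (hzR : ‖z‖ ≤ R)
    (hzc : ∀ y ∈ P.Y, eval z.ofLp (P.pAt y) ≤ -c)
    {u : EuclideanSpace ℝ (Fin m)} (huR : ‖u‖ ≤ R) (huφ : ∀ j, eval u.ofLp (P.φ j) ≤ 0)
    (hup : ∀ y ∈ P.Y, eval u.ofLp (P.pAt y) ≤ ε) :
    Metric.infDist u (P.K ∩ Metric.closedBall 0 R) ≤ 2 * R / c * ε := by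
  have hden : 0 < c + ε := by linarith
  refine (Metric.infDist_le_dist_of_mem
    (combo_mem_K hε hc hφ hp hz hzR hzc huR huφ hup)).trans ?_
  have e : u - ((c / (c + ε)) • u + (ε / (c + ε)) • z) = (ε / (c + ε)) • (u - z) := by
    have h1 : c / (c + ε) = 1 - ε / (c + ε) := by field_simp; ring
    rw [h1]
    module
  rw [dist_eq_norm, e, norm_smul, Real.norm_of_nonneg (by positivity)]
  have h1 : ‖u - z‖ ≤ 2 * R := (norm_sub_le _ _).trans (by linarith)
  have h2 : ε / (c + ε) ≤ ε / c := by gcongr; linarith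
  calc ε / (c + ε) * ‖u - z‖ ≤ ε / c * (2 * R) := by gcongr
    _ = 2 * R / c * ε := by ring

/-- A convex function that is nonnegative on `K` is at least `-O(ε)` at such a point, by convexity
along the segment to the Slater point. -/
theorem neg_le_eval_of_violation_le {R ε c : ℝ} (hε : 0 ≤ ε) (hc : 0 < c)
    (hφ : ∀ j, IsSosConvex (P.φ j)) (hp : ∀ y ∈ P.Y, IsSosConvex (P.pAt y))
    {z : EuclideanSpace ℝ (Fin m)} (hz : z ∈ P.K) (hzR : ‖z‖ ≤ R)
    (hzc : ∀ y ∈ P.Y, eval z.ofLp (P.pAt y) ≤ -c)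
    {u : EuclideanSpace ℝ (Fin m)} (huR : ‖u‖ ≤ R) (huφ : ∀ j, eval u.ofLp (P.φ j) ≤ 0)
    (hup : ∀ y ∈ P.Y, eval u.ofLp (P.pAt y) ≤ ε)
    {F : MvPolynomial (Fin m) ℝ} (hF : IsSosConvex F) (hFK : ∀ x ∈ P.K, 0 ≤ eval x.ofLp F) :
    -(eval z.ofLp F / c * ε) ≤ eval u.ofLp F := by
  have hden : 0 < c + ε := by linarith
  have h0 := hFK _ (combo_mem_K hε hc hφ hp hz hzR hzc huR huφ hup).1
  have h1 := hF.eval_combo_le u z (α := c / (c + ε)) (β := ε / (c + ε)) (by positivity)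
    (by positivity) (by field_simp)
  have h2 : 0 ≤ (c * eval u.ofLp F + ε * eval z.ofLp F) / (c + ε) := by
    refine (h0.trans h1).trans_eq ?_
    field_simp
  have h3 : 0 ≤ c * eval u.ofLp F + ε * eval z.ofLp F := by
    have := mul_nonneg h2 hden.le
    rwa [div_mul_cancel₀ _ hden.ne'] at this
  have h4 : -(eval z.ofLp F / c * ε) = -(ε * eval z.ofLp F) / c := by ring
  rw [h4, div_le_iff₀ hc]
  linarith

/-! ### The objective -/

theorem rStar_eq {u : EuclideanSpace ℝ (Fin m)} (hu : u ∈ P.S) : P.rStar = P.obj u := by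
  refine IsLeast.csInf_eq ⟨Set.mem_image_of_mem _ hu.1, ?_⟩
  rintro _ ⟨z, hz, rfl⟩
  exact hu.2 z hz

/-- The polynomial `f - r⋆ g`. -/
noncomputable def reducedObj (P : FSIPP m n s) : MvPolynomial (Fin m) ℝ := P.f - C P.rStar * P.g

theorem totalDegree_reducedObj_le : P.reducedObj.totalDegree ≤ 2 * P.d := by
  refine (totalDegree_sub _ _).trans (max_le ((mem_restrictTotalDegree _ _ _).1 P.f_mem) ?_)
  refine (totalDegree_mul _ _).trans ?_
  rw [totalDegree_C, zero_add]
  exact (mem_restrictTotalDegree _ _ _).1 P.g_mem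

theorem eval_reducedObj_nonneg {u : EuclideanSpace ℝ (Fin m)} (hu : u ∈ P.S)
    (hg : ∀ x ∈ P.K, 0 < eval x.ofLp P.g) {x : EuclideanSpace ℝ (Fin m)} (hx : x ∈ P.K) :
    0 ≤ eval x.ofLp P.reducedObj := by
  have h := hu.2 x hx
  rw [← rStar_eq hu, obj, le_div_iff₀ (hg x hx)] at h
  rw [reducedObj, map_sub, map_mul, eval_C]
  linarith

theorem isSosConvex_reducedObj {u : EuclideanSpace ℝ (Fin m)} (hu : u ∈ P.S)
    (hf : IsSosConvex P.f) (hg : IsSosConvex (-P.g))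
    (hfg : (∀ x ∈ P.K, 0 < eval x.ofLp P.f ∧ 0 < eval x.ofLp P.g) ∨
      (P.g.totalDegree ≤ 1 ∧ ∀ x ∈ P.K, 0 < eval x.ofLp P.g)) :
    IsSosConvex P.reducedObj := by
  have e : P.reducedObj = P.f + C P.rStar * -P.g := by rw [reducedObj]; ring
  rw [e]
  refine hf.add ?_
  rcases hfg with h | ⟨h, -⟩
  · refine hg.C_mul ?_
    rw [rStar_eq hu]
    exact (div_pos (h u hu.1).1 (h u hu.1).2).le
  · refine isSosConvex_of_totalDegree_le_one ((totalDegree_mul _ _).trans ?_)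
    rwa [totalDegree_C, zero_add, totalDegree_neg]

/-- The normalized evaluation at a minimizer is feasible for the dual relaxation. -/
theorem evalLin_mem_dualFeasible {R gStar : ℝ} (hgStar : 0 < gStar)
    {u : EuclideanSpace ℝ (Fin m)} (hu : u ∈ P.K) (huR : ‖u‖ < R)
    (hug : gStar < eval u.ofLp P.g) (hYm : MeasurableSet P.Y) (k : ℕ) :
    ((eval u.ofLp P.g)⁻¹ • evalLin u.ofLp).comp P.polyX.subtype ∈ P.dualFeasible R gStar k := by
  have hg0 : 0 < eval u.ofLp P.g := hgStar.trans hug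
  have hext : P.Extends ((eval u.ofLp P.g)⁻¹ • evalLin u.ofLp)
      (((eval u.ofLp P.g)⁻¹ • evalLin u.ofLp).comp P.polyX.subtype) := fun q => rfl
  have happ : ∀ q, ((eval u.ofLp P.g)⁻¹ • evalLin u.ofLp) q =
      (eval u.ofLp P.g)⁻¹ * eval u.ofLp q := fun q => by simp
  refine ⟨fun q hq => ?_, ?_, ⟨?_, fun σ hσ _ => ?_⟩, fun j => ?_⟩
  · obtain ⟨σ₀, σ₁, σ₂, h0, h1, h2, -, -, -, e⟩ := hq
    rw [hext, happ, e]
    refine mul_nonneg (inv_pos.2 hg0).le ?_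
    have hball : 0 ≤ eval u.ofLp (ballPoly m R) := by
      have h3 : ‖u‖ ^ 2 ≤ R ^ 2 := pow_le_pow_left₀ (norm_nonneg u) huR.le 2
      rw [EuclideanSpace.norm_sq_eq] at h3
      simpa [ballPoly] using h3
    rw [map_add, map_add, map_mul, map_mul, map_sub, eval_C]
    have h3 := h0.eval_nonneg u.ofLp
    have h4 := mul_nonneg (h1.eval_nonneg u.ofLp) hball
    have h5 := mul_nonneg (h2.eval_nonneg u.ofLp) (sub_nonneg.2 hug.le)
    linarith
  · rw [hext, happ]
    exact inv_mul_cancel₀ hg0.ne'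
  · rw [totalDegree_neg]
    exact totalDegree_applyP_le _
  · refine setIntegral_nonneg hYm fun y hy => mul_nonneg ?_ (hσ.eval_nonneg _)
    rw [map_neg, hext.eval_applyP, happ, neg_nonneg]
    exact mul_nonpos_of_nonneg_of_nonpos (inv_pos.2 hg0).le (hu.2 y hy)
  · rw [hext, happ]
    exact mul_nonpos_of_nonneg_of_nonpos (inv_pos.2 hg0).le (hu.1 j)

theorem rDual_le_rStar {R gStar : ℝ} (hgStar : 0 < gStar)
    {u : EuclideanSpace ℝ (Fin m)} (hu : u ∈ P.S) (huR : ‖u‖ < R)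
    (hug : gStar < eval u.ofLp P.g) (hYm : MeasurableSet P.Y) (k : ℕ) :
    P.rDual R gStar k ≤ (P.rStar : EReal) := by
  refine (iInf₂_le _ (evalLin_mem_dualFeasible hgStar hu.1 huR hug hYm k)).trans_eq ?_
  rw [rStar_eq hu, obj, div_eq_inv_mul]
  simp

/-- The bounds on pseudo-moments keep all the dual relaxations bounded below, for every `k`. -/
theorem exists_forall_le_rDual (hd : 1 ≤ P.d) (R : ℝ) {gStar : ℝ} (hgStar : 0 < gStar) :
    ∃ b : ℝ, ∀ k, (b : EReal) ≤ P.rDual R gStar k := by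
  refine ⟨-((∑ α ∈ P.f.support, |P.f.coeff α|) * ((1 + R ^ 2) ^ P.d * (1 / gStar))), fun k => ?_⟩
  refine le_iInf₂ fun L hL => EReal.coe_le_coe_iff.2 ?_
  obtain ⟨Λ, h⟩ := P.exists_extends L
  rw [h]
  have h1 := (h.isBallPseudoMoment_of_dualFeasible hd hL).abs_map_le
    ((mem_restrictTotalDegree _ _ _).1 P.f_mem)
  refine neg_le_of_abs_le (h1.trans ?_)
  have h2 := h.map_one_le hgStar hL
  have h3 : 0 ≤ ∑ α ∈ P.f.support, |P.f.coeff α| := Finset.sum_nonneg fun _ _ => abs_nonneg _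
  gcongr

end FSIPP

theorem mainTheorem4 {m n s : ℕ} (P : FSIPP m n s)
    -- the coordinates belong to the space of polynomials of degree at most `2d`
    (hd : 1 ≤ P.d)
    -- the constants `R` and `g⋆`
    (R gStar : ℝ) (hR : 0 < R) (hgStar : 0 < gStar)
    (hRg : ∃ u ∈ P.S, ‖u‖ < R ∧ gStar < MvPolynomial.eval u.ofLp P.g)
    -- `Y` is a closed subset of the cube, and the constraints are s.o.s-convex
    (hYcube : ∀ y ∈ P.Y, ∀ i, y i ∈ Set.Icc (-1 : ℝ) 1)
    (hYclosed : IsClosed P.Y)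
    (hφ : ∀ j, IsSosConvex (P.φ j))
    (hp : ∀ y ∈ P.Y, IsSosConvex (P.pAt y))
    -- the objective
    (hf : IsSosConvex P.f)
    (hg : IsSosConvex (-P.g))
    (hfg : (∀ x ∈ P.K, 0 < MvPolynomial.eval x.ofLp P.f ∧ 0 < MvPolynomial.eval x.ofLp P.g) ∨
      (P.g.totalDegree ≤ 1 ∧ ∀ x ∈ P.K, 0 < MvPolynomial.eval x.ofLp P.g))
    -- the Slater condition for `K`
    (hSlater : ∃ u ∈ P.K, (∀ y ∈ P.Y, MvPolynomial.eval u.ofLp (P.pAt y) < 0) ∧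
      ∀ j, MvPolynomial.eval u.ofLp (P.φ j) < 0)
    -- the Slater condition in the ball of radius `R`
    (hSlaterBall : ∃ x : EuclideanSpace ℝ (Fin m), ‖x‖ < R ∧
      ∀ y ∈ P.Y, MvPolynomial.eval x.ofLp (P.pAt y) < 0)
    -- the uniform lower volume density of `Y`
    (hDensity : ∃ ε η : ℝ, 0 < ε ∧ 0 < η ∧ ∀ y ∈ P.Y, ∀ δ : ℝ, 0 < δ → δ < ε →
      ENNReal.ofReal η * MeasureTheory.volume (Metric.closedBall y δ) ≤
        MeasureTheory.volume (Metric.closedBall y δ ∩ P.Y)) :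
    (∃ C : ℝ, ∀ᶠ k : ℕ in Filter.atTop, ∀ u ∈ P.Lam hd R k,
      Metric.infDist u (P.K ∩ Metric.closedBall 0 R) ≤ C * (Real.log k / k)) ∧
    (∃ r : ℕ → ℝ, (∀ k, P.rDual R gStar k = (r k : EReal)) ∧
      (∀ k, 0 ≤ P.rStar - r k) ∧
      (fun k : ℕ => P.rStar - r k) =O[Filter.atTop] fun k : ℕ => Real.log k / k) := by
  have hYc := isCompact_of_subset_cube hYcube hYclosed
  obtain ⟨uS, huS, huSR, huSg⟩ := hRg
  obtain ⟨uSl, huSlK, huSlp, -⟩ := hSlater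
  obtain ⟨z, hzK, hzR, c, hc, hzc⟩ :=
    FSIPP.exists_slater_in_ball hYc hφ hp huS.1 huSR huSlK huSlp
  obtain ⟨A, hA, hrate⟩ := FSIPP.exists_rate_outerFeasible hd R hYcube hYclosed hDensity
  have hε : ∀ k : ℕ, 0 ≤ A * (Real.log k / k) := fun k =>
    mul_nonneg hA.le (div_nonneg (Real.log_natCast_nonneg k) (Nat.cast_nonneg k))
  -- the moment vectors of the functionals are almost feasible
  have hfeas : ∀ᶠ k : ℕ in atTop, ∀ L ∈ P.outerFeasible R k, ∀ Λ, P.Extends Λ L →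
      ∀ u : EuclideanSpace ℝ (Fin m), (∀ i, u i = Λ (X i)) →
      ‖u‖ ≤ R ∧ (∀ j, eval u.ofLp (P.φ j) ≤ 0) ∧
        ∀ y ∈ P.Y, eval u.ofLp (P.pAt y) ≤ A * (Real.log k / k) := by
    filter_upwards [hrate] with k hk L hL Λ h u hu
    refine ⟨(h.isBallPseudoMoment hd hL).norm_le hd hR.le (by rw [← hL.2.2.2.1, h]) u hu,
      fun j => ?_, fun y hy => ?_⟩
    · refine (h.jensen hd hL hu (hφ j) ((mem_restrictTotalDegree _ _ _).1 (P.φ_mem j))).trans ?_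
      have := hL.2.2.2.2 j
      rwa [h] at this
    · exact (h.jensen hd hL hu (hp y hy) (P.totalDegree_pAt_le y)).trans (hk L hL Λ h y hy)
  refine ⟨⟨2 * R / c * A, ?_⟩, ?_⟩
  · filter_upwards [hfeas] with k hk u hu
    obtain ⟨L, hL, huL⟩ := hu
    obtain ⟨Λ, h⟩ := P.exists_extends L
    obtain ⟨h1, h2, h3⟩ := hk L hL Λ h u fun i => (huL i).trans (h _)
    rw [mul_assoc]
    exact FSIPP.infDist_le_of_violation_le (hε k) hc hφ hp hzK hzR hzc h1 h2 h3
  · obtain ⟨b, hb⟩ := FSIPP.exists_forall_le_rDual (P := P) hd R hgStar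
    have hle := FSIPP.rDual_le_rStar hgStar huS huSR huSg hYclosed.measurableSet
    have hr : ∀ k, P.rDual R gStar k = ((P.rDual R gStar k).toReal : EReal) := fun k =>
      (EReal.coe_toReal ((hle k).trans_lt (EReal.coe_lt_top _)).ne
        ((EReal.bot_lt_coe _).trans_le (hb k)).ne').symm
    have hr0 : ∀ k, 0 ≤ P.rStar - (P.rDual R gStar k).toReal := fun k => by
      have := hle k
      rw [hr k, EReal.coe_le_coe_iff] at this
      linarith
    have hgK : ∀ x ∈ P.K, 0 < eval x.ofLp P.g := fun x hx =>
      hfg.elim (fun h => (h x hx).2) fun h => h.2 x hx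
    have hF := FSIPP.isSosConvex_reducedObj huS hf hg hfg
    have hFK := fun x (hx : x ∈ P.K) => FSIPP.eval_reducedObj_nonneg huS hgK hx
    refine ⟨fun k => (P.rDual R gStar k).toReal, hr, hr0, ?_⟩
    refine IsBigO.of_bound (1 / gStar * (eval z.ofLp P.reducedObj / c * A)) ?_
    filter_upwards [hfeas] with k hk
    rw [Real.norm_of_nonneg (hr0 k), Real.norm_of_nonneg
      (div_nonneg (Real.log_natCast_nonneg k) (Nat.cast_nonneg k)), sub_le_comm,
      ← EReal.coe_le_coe_iff, ← hr k]
    refine le_iInf₂ fun L hL => EReal.coe_le_coe_iff.2 ?_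
    obtain ⟨Λ, h⟩ := P.exists_extends L
    have hpos := h.map_one_pos hd hL
    have hL' := h.normalize_mem hd hL
    have h' := h.smul (Λ 1)⁻¹
    -- the bound on the violation, applied to the normalization of `L`
    set u : EuclideanSpace ℝ (Fin m) := WithLp.toLp 2 fun i => ((Λ 1)⁻¹ • Λ) (X i) with hu
    obtain ⟨h1, h2, h3⟩ := hk _ hL' _ h' u fun i => rfl
    have h4 := FSIPP.neg_le_eval_of_violation_le (hε k) hc hφ hp hzK hzR hzc h1 h2 h3 hF hFK
    have h5 := h'.jensen hd hL' (u := u) (fun i => rfl) hF FSIPP.totalDegree_reducedObj_le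
    have h6 : Λ P.reducedObj = L ⟨P.f, P.f_mem⟩ - P.rStar := by
      have hLg : Λ P.g = 1 := (h ⟨P.g, P.g_mem⟩).symm.trans hL.2.1
      rw [FSIPP.reducedObj, map_sub, map_C_mul, hLg, mul_one, h]
    rw [LinearMap.smul_apply, smul_eq_mul, h6] at h5
    have h7 := h4.trans h5
    rw [le_inv_mul_iff₀ hpos] at h7
    have h8 : Λ 1 * (eval z.ofLp P.reducedObj / c * (A * (Real.log k / k))) ≤
        1 / gStar * (eval z.ofLp P.reducedObj / c * (A * (Real.log k / k))) :=
      mul_le_mul_of_nonneg_right (h.map_one_le hgStar hL)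
        (mul_nonneg (div_nonneg (hFK z hzK) hc.le) (hε k))
    linarith
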